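/- Throughout, $\kappa,\lambda,\mu$ denote infinite regular cardinals. An \emph{AECat} is a pair $(\mathcal C,\mathcal M)$ where $\mathcal C$ and $\mathcal M$ are accessible categories, $\mathcal M$ is a full subcategory of $\mathcal C$ which has directed colimits, preserved by the inclusion into $\mathcal C$, and all arrows of $\mathcal C$ are monomorphisms. Objects of $\mathcal M$ are called \emph{models}, and an \emph{extension} of a model $M$ is an arrow $M\to N$ with $N$ a model. The AECat has the \emph{amalgamation property} if every span $N_1\leftarrow M\to N_2$ of models can be completed to a commutative square $N_1\to U\leftarrow N_2$ with $U$ a model. Given an extension $M\to N$, we view arrows into $M$ (and subobjects of $M$) as arrows into $N$ (subobjects of $N$) by composition. \textbf{Galois types.} For tuples of arrows $a_i:A_i\to M$ and $a_i':A_i\to M'$ into models, $\mathrm{gtp}((a_i)_i;M)=\mathrm{gtp}((a'_i)_i;M')$ means that there are extensions $M\to N\leftarrow M'$ such that $a_i$ and $a_i'$ become the same arrow into $N$ for all $i$. For tuples of subobjects, $\mathrm{gtp}((A_i)_i;M)=\mathrm{gtp}((A_i')_i;M')$ means that there are extensions $M\to N\leftarrow M'$ such that $A_i=A_i'$ as subobjects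 of $N$ for all $i$. \textbf{Isi-dividing.} An \emph{isi-sequence} over $c:C\to N$ consists of a sequence $(b_i)_{i<\lambda}$ of arrows $B\to N$ into a model $N$ together with a chain $(M_i)_{i<\lambda}$ of models with a cocone $m_i:M_i\to N$, such that $M_\ell=\operatorname{colim}_{i<\ell}M_i$ for limit $\ell<\lambda$, each $b_i$ factors through $m_{i+1}$, $c$ factors through $m_0$, and $\mathrm{gtp}(b_i,m_i;N)=\mathrm{gtp}(b_j,m_i;N)$ for all $i\le j<\lambda$. For arrows $a,b,c$ into a model $M$ and a sequence $(b_i)_{i\in I}$ in a model $N$ with an arrow $c:C\to N$, $\mathrm{gtp}(a,b,c;M)$ is \emph{consistent} for $(b_i)_{i\in I}$ if there are an extension $N\to N'$ and $a':A\to N'$ with $\mathrm{gtp}(a,b,c;M)=\mathrm{gtp}(a',b_i,c;N')$ for all $i\in I$. We say that $\mathrm{gtp}(a,b,c;M)$ \emph{isi-divides} over $c$ if there is $\mu$ such that for every $\lambda\ge\mu$ there is an isi-sequence $(b_i)_{i<\lambda}$ over $c$ in some model $N$ with $\mathrm{gtp}(b_i,c;N)=\mathrm{gtp}(b,c;M)$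 for all $i<\lambda$, such that for some $\kappa<\lambda$ and every $I\subseteq\lambda$ with $|I|\ge\kappa$, $\mathrm{gtp}(a,b,c;M)$ is inconsistent for $(b_i)_{i\in I}$. For subobjects $A,B,C$ of $M$, $\mathrm{gtp}(A,B,C;M)$ isi-divides over $C$ if $\mathrm{gtp}(a,b,c;M)$ isi-divides over $c$, where $a,b,c$ are representatives of $A,B,C$. \textbf{Simple independence relations.} An \emph{independence relation} is a relation $A\perp^M_C B$ on triples of subobjects of models $M$. Below, capital letters denote the subobjects represented by the corresponding lower case arrows. It is \emph{simple} if it has the following properties. \begin{itemize} \item Invariance: if $A\perp^M_C B$ and $\mathrm{gtp}(A,B,C;M)=\mathrm{gtp}(A',B',C';M')$ then $A'\perp^{M'}_{C'}B'$. \item Monotonicity: $A\perp^M_C B$ and $B'\le B$ imply $A\perp^M_C B'$. \item Base-monotonicity: $A\perp^M_C B$ and $C\le C'\le B$ imply $A\perp^M_{C'}B$. \item Transitivity: $A\perp^M_B C$, $A\perp^M_C D$ and $B\le C$ imply that there are an extension $M\to N$ and $E\le N$ with $A\perp^N_B E$ and $C,D\le E$. \item Symmetry: $A\perp^M_C B$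 implies $B\perp^M_C A$. \item Existence: for arrows $a:A\to M$ and $c:C\to M$ and any $B\le M$ there are an extension $M\to M'$ and $a':A\to M'$ with $A'\perp^{M'}_C B$ and $\mathrm{gtp}(a',c;M')=\mathrm{gtp}(a,c;M)$. \item Union: if $(B_i)_{i\in I}$ is a directed system in $\mathcal C$ with a cocone into a model $M$, $B=\operatorname{colim}_iB_i$ exists in $\mathcal C$, and $A\perp^M_C B_i$ for all $i$, then $A\perp^M_C B$. \item Local character: for every $\lambda$ there is $\Upsilon(\lambda)$ such that for all subobjects $A,B$ of a model $M$ with $A$ $\lambda$-presentable in $\mathcal C$ there is an $\Upsilon(\lambda)$-presentable $B'\le B$ with $A\perp^M_{B'}B$. \item 3-amalgamation: suppose that $A\perp^{N_1}_M B$, $B\perp^{N_2}_M C$, $C\perp^{N_3}_M A$ with $M$ a model, represented by arrows $a$ into $N_1,N_3$, $b$ into $N_1,N_2$, $c$ into $N_2,N_3$ and $m$ into $N_1,N_2,N_3$, such that $\mathrm{gtp}(a,m;N_1)=\mathrm{gtp}(a,m;N_3)$, $\mathrm{gtp}(b,m;N_1)=\mathrm{gtp}(b,m;N_2)$ and $\mathrm{gtp}(c,m;N_2)=\mathrm{gtp}(c,m;N_3)$.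 Then there are extensions $N_1,N_2,N_3\to N$ such that the two composites $A\to N$, the two composites $B\to N$, the two composites $C\to N$ and the three composites $M\to N$ coincide, and $A\perp^N_M N_2$. \end{itemize} \textbf{Theorem (Kim--Pillay theorem for AECats).} Let $(\mathcal C,\mathcal M)$ be an AECat with the amalgamation property and let $\perp$ be a simple independence relation on it. Let $A,B,C$ be subobjects of a model $M$. Then $A\perp^M_C B$ if and only if $\mathrm{gtp}(A,B,C;M)$ does not isi-divide over $C$ (for any choice of representatives of $A$, $B$, $C$). -/

import Mathlib

open CategoryTheory CategoryTheory.Limits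

universe v u

set_option linter.checkUnivs false in
/-- An AECat (abstract elementary category): an accessible category `Obj` with a full
subcategory of *models* (given by the property `IsModel` of objects), which is itself accessible
and has directed colimits that are preserved by the inclusion, such that all arrows of `Obj` are
monomorphisms. "Small" means small relative to the universe `v` of the hom-sets; directed colimits
are the colimits of diagrams indexed by (small) nonempty directed posets. -/
structure AECat where
  /-- the objects of the ambient category -/
  Obj : Type u
  [category : Category.{v} Obj]
  /-- the objects that are models -/
  IsModel : ObjectProperty Obj
  accessible : IsAccessibleCategory.{v} Obj
  accessible_models : IsAccessibleCategory.{v} IsModel.FullSubcategory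
  hasDirectedColimits : ∀ (J : Type v) [PartialOrder J] [IsDirectedOrder J] [Nonempty J],
    HasColimitsOfShape J IsModel.FullSubcategory
  preservesDirectedColimits : ∀ (J : Type v) [PartialOrder J] [IsDirectedOrder J] [Nonempty J],
    PreservesColimitsOfShape J IsModel.ι
  mono : ∀ {X Y : Obj} (f : X ⟶ Y), Mono f

namespace AECat

instance (𝒦 : AECat.{v, u}) : Category.{v} 𝒦.Obj := 𝒦.category

instance (𝒦 : AECat.{v, u}) {X Y : 𝒦.Obj} (f : X ⟶ Y) : Mono f := 𝒦.mono f

/-- The models of an AECat. As they form a full subcategory, arrows `M ⟶ N` of models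
(*extensions*) are written as arrows `M.obj ⟶ N.obj`. -/
abbrev Model (𝒦 : AECat.{v, u}) : Type u := 𝒦.IsModel.FullSubcategory

/-- The amalgamation property, for spans of models. -/
def AmalgamationProperty (𝒦 : AECat.{v, u}) : Prop :=
  ∀ (M N₁ N₂ : 𝒦.Model) (f₁ : M.obj ⟶ N₁.obj) (f₂ : M.obj ⟶ N₂.obj),
    ∃ (U : 𝒦.Model) (g₁ : N₁.obj ⟶ U.obj) (g₂ : N₂.obj ⟶ U.obj), f₁ ≫ g₁ = f₂ ≫ g₂

variable {𝒦 : AECat.{v, u}}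

/-- `gtp(x, y; M) = gtp(x', y'; M')`: equality of Galois types of pairs of arrows into models. -/
def GtpEq₂ {X Y : 𝒦.Obj} {M M' : 𝒦.Model} (x : X ⟶ M.obj) (y : Y ⟶ M.obj)
    (x' : X ⟶ M'.obj) (y' : Y ⟶ M'.obj) : Prop :=
  ∃ (N : 𝒦.Model) (f : M.obj ⟶ N.obj) (g : M'.obj ⟶ N.obj), x ≫ f = x' ≫ g ∧ y ≫ f = y' ≫ g

/-- `gtp(x, y, z; M) = gtp(x', y', z'; M')`: equality of Galois types of triples of arrows into
models. -/
def GtpEq₃ {X Y Z : 𝒦.Obj} {M M' : 𝒦.Model} (x : X ⟶ M.obj) (y : Y ⟶ M.obj) (z : Z ⟶ M.obj)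
    (x' : X ⟶ M'.obj) (y' : Y ⟶ M'.obj) (z' : Z ⟶ M'.obj) : Prop :=
  ∃ (N : 𝒦.Model) (f : M.obj ⟶ N.obj) (g : M'.obj ⟶ N.obj),
    x ≫ f = x' ≫ g ∧ y ≫ f = y' ≫ g ∧ z ≫ f = z' ≫ g

/-- A subobject of `X`, viewed as a subobject of `Y` along an arrow `X ⟶ Y`. -/
noncomputable def push {X Y : 𝒦.Obj} (f : X ⟶ Y) (A : Subobject X) : Subobject Y :=
  (Subobject.map f).obj A

/-- `gtp(A, B, C; M) = gtp(A', B', C'; M')` for triples of subobjects of models. -/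
def SubGtpEq {M M' : 𝒦.Model} (A B C : Subobject M.obj) (A' B' C' : Subobject M'.obj) : Prop :=
  ∃ (N : 𝒦.Model) (f : M.obj ⟶ N.obj) (g : M'.obj ⟶ N.obj),
    push f A = push g A' ∧ push f B = push g B' ∧ push f C = push g C'

/-! ### Isi-sequences and isi-dividing -/

/-- A chain of initial segments for a sequence `(b i)`, `i < κ`, of arrows into a model `N`:
a continuous chain of models with a cocone to `N` such that every `b i` factors through the
`(i + 1)`-st model. Ordinals `i < κ` are the elements of `κ.ord.ToType`. -/
structure InitialSegments {κ : Cardinal.{v}} {Y : 𝒦.Obj} {N : 𝒦.Model}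
    (b : κ.ord.ToType → (Y ⟶ N.obj)) where
  chain : κ.ord.ToType ⥤ 𝒦.Obj
  isModel : ∀ i, 𝒦.IsModel (chain.obj i)
  continuous : chain.IsWellOrderContinuous
  toBound : chain ⟶ (Functor.const κ.ord.ToType).obj N.obj
  factors : ∀ i, ∃ g : Y ⟶ chain.obj (Order.succ i), g ≫ toBound.app (Order.succ i) = b i

/-- The arrow `mᵢ : Mᵢ ⟶ N` of a chain of initial segments. -/
def InitialSegments.m {κ : Cardinal.{v}} {Y : 𝒦.Obj} {N : 𝒦.Model}
    {b : κ.ord.ToType → (Y ⟶ N.obj)} (S : InitialSegments b) (i : κ.ord.ToType) :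
    S.chain.obj i ⟶ N.obj :=
  S.toBound.app i

/-- A sequence with a chain of initial segments is an isi-sequence (initial segment invariant)
if `gtp(bᵢ, mᵢ; N) = gtp(bⱼ, mᵢ; N)` for all `i ≤ j < κ`. -/
def InitialSegments.IsIsi {κ : Cardinal.{v}} {Y : 𝒦.Obj} {N : 𝒦.Model}
    {b : κ.ord.ToType → (Y ⟶ N.obj)} (S : InitialSegments b) : Prop :=
  ∀ i j, i ≤ j → GtpEq₂ (b i) (S.m i) (b j) (S.m i)

/-- `c : Z ⟶ N` embeds in the chain, that is, factors as `Z ⟶ M₀ ⟶ N` (compatibly with the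
cocone). For `κ > 0` there is exactly one minimal index. -/
def InitialSegments.Embeds {κ : Cardinal.{v}} {Y Z : 𝒦.Obj} {N : 𝒦.Model}
    {b : κ.ord.ToType → (Y ⟶ N.obj)} (S : InitialSegments b) (c : Z ⟶ N.obj) : Prop :=
  ∃ (i₀ : κ.ord.ToType) (_ : IsBot i₀) (h : Z ⟶ S.chain.obj i₀), h ≫ S.m i₀ = c

/-- `gtp(a, b, c; M)` is consistent for the sequence `(bs i)`, `i ∈ I`, of arrows into `N`, where
`c'` is the arrow into `N` that plays the role of `c`: there is an extension `f : N ⟶ N'` and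
`a' : X ⟶ N'` with `gtp(a, b, c; M) = gtp(a', bs i, c'; N')` for all `i`. -/
def Consistent {X Y Z : 𝒦.Obj} {M N : 𝒦.Model}
    (a : X ⟶ M.obj) (b : Y ⟶ M.obj) (c : Z ⟶ M.obj)
    {I : Type v} (bs : I → (Y ⟶ N.obj)) (c' : Z ⟶ N.obj) : Prop :=
  ∃ (N' : 𝒦.Model) (f : N.obj ⟶ N'.obj) (a' : X ⟶ N'.obj),
    ∀ i, GtpEq₃ a b c a' (bs i ≫ f) (c' ≫ f)

/-- `gtp(a, b, c; M)` isi-divides over `c`. The cardinals `μ`, `θ`, `κ` range over infinite regular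
cardinals. -/
def IsiDivides {X Y Z : 𝒦.Obj} {M : 𝒦.Model}
    (a : X ⟶ M.obj) (b : Y ⟶ M.obj) (c : Z ⟶ M.obj) : Prop :=
  ∃ μ : Cardinal.{v}, μ.IsRegular ∧ ∀ θ : Cardinal.{v}, θ.IsRegular → μ ≤ θ →
    ∃ (N : 𝒦.Model) (c' : Z ⟶ N.obj) (bs : θ.ord.ToType → (Y ⟶ N.obj))
      (S : InitialSegments bs),
      S.IsIsi ∧ S.Embeds c' ∧ (∀ i, GtpEq₂ (bs i) c' b c) ∧
      ∃ κ : Cardinal.{v}, κ.IsRegular ∧ κ < θ ∧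
        ∀ I : Set θ.ord.ToType, κ ≤ Cardinal.mk I →
          ¬ Consistent a b c (fun i : I => bs i) c'

/-! ### Independence relations -/

/-- An independence relation: a relation on triples of subobjects of models. `R A B C`, for
subobjects `A`, `B`, `C` of a model `M`, reads "`A` is independent from `B` over `C` in `M`". -/
def IndepRel (𝒦 : AECat.{v, u}) : Type (max u v) :=
  ∀ ⦃M : 𝒦.Model⦄, Subobject M.obj → Subobject M.obj → Subobject M.obj → Prop

namespace IndepRel

variable (R : IndepRel 𝒦)

def Invariance : Prop :=
  ∀ ⦃M M' : 𝒦.Model⦄ (A B C : Subobject M.obj) (A' B' C' : Subobject M'.obj),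
    R A B C → SubGtpEq A B C A' B' C' → R A' B' C'

def Monotonicity : Prop :=
  ∀ ⦃M : 𝒦.Model⦄ (A B B' C : Subobject M.obj), R A B C → B' ≤ B → R A B' C

def BaseMonotonicity : Prop :=
  ∀ ⦃M : 𝒦.Model⦄ (A B C C' : Subobject M.obj), R A B C → C ≤ C' → C' ≤ B → R A B C'

def Transitivity : Prop :=
  ∀ ⦃M : 𝒦.Model⦄ (A B C D : Subobject M.obj), R A C B → R A D C → B ≤ C →
    ∃ (N : 𝒦.Model) (f : M.obj ⟶ N.obj) (E : Subobject N.obj),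
      R (push f A) E (push f B) ∧ push f C ≤ E ∧ push f D ≤ E

def Symmetry : Prop :=
  ∀ ⦃M : 𝒦.Model⦄ (A B C : Subobject M.obj), R A B C → R B A C

def Existence : Prop :=
  ∀ ⦃M : 𝒦.Model⦄ ⦃X Z : 𝒦.Obj⦄ (a : X ⟶ M.obj) (c : Z ⟶ M.obj) (B : Subobject M.obj),
    ∃ (M' : 𝒦.Model) (f : M.obj ⟶ M'.obj) (a' : X ⟶ M'.obj),
      R (Subobject.mk a') (push f B) (Subobject.mk (c ≫ f)) ∧ GtpEq₂ a' (c ≫ f) a c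

/-- If a directed system has a colimit `s` in the ambient category and a cocone into a model `M`,
corresponding to an arrow `d : s.pt ⟶ M`, and `A` is independent over `C` from every object of the
system, then `A` is independent over `C` from the colimit. -/
def Union : Prop :=
  ∀ (J : Type v) [PartialOrder J] [IsDirectedOrder J] [Nonempty J] (F : J ⥤ 𝒦.Obj)
    (s : Cocone F) (_ : IsColimit s) ⦃M : 𝒦.Model⦄ (d : s.pt ⟶ M.obj) (A C : Subobject M.obj),
    (∀ j, R A (Subobject.mk (s.ι.app j ≫ d)) C) → R A (Subobject.mk d) C

def LocalCharacter : Prop :=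
  ∀ (κ : Cardinal.{v}) [Fact κ.IsRegular], ∃ (Υ : Cardinal.{v}) (_ : Fact Υ.IsRegular),
    ∀ ⦃M : 𝒦.Model⦄ (A B : Subobject M.obj), IsCardinalPresentable (A : 𝒦.Obj) κ →
      ∃ B' : Subobject M.obj, B' ≤ B ∧ IsCardinalPresentable (B' : 𝒦.Obj) Υ ∧ R A B B'

def ThreeAmalgamation : Prop :=
  ∀ ⦃A B C : 𝒦.Obj⦄ ⦃M N₁ N₂ N₃ : 𝒦.Model⦄
    (a₁ : A ⟶ N₁.obj) (a₃ : A ⟶ N₃.obj) (b₁ : B ⟶ N₁.obj) (b₂ : B ⟶ N₂.obj)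
    (c₂ : C ⟶ N₂.obj) (c₃ : C ⟶ N₃.obj)
    (m₁ : M.obj ⟶ N₁.obj) (m₂ : M.obj ⟶ N₂.obj) (m₃ : M.obj ⟶ N₃.obj),
    R (Subobject.mk a₁) (Subobject.mk b₁) (Subobject.mk m₁) →
    R (Subobject.mk b₂) (Subobject.mk c₂) (Subobject.mk m₂) →
    R (Subobject.mk c₃) (Subobject.mk a₃) (Subobject.mk m₃) →
    GtpEq₂ a₁ m₁ a₃ m₃ → GtpEq₂ b₁ m₁ b₂ m₂ → GtpEq₂ c₂ m₂ c₃ m₃ →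
    ∃ (N : 𝒦.Model) (f₁ : N₁.obj ⟶ N.obj) (f₂ : N₂.obj ⟶ N.obj) (f₃ : N₃.obj ⟶ N.obj),
      a₁ ≫ f₁ = a₃ ≫ f₃ ∧ b₁ ≫ f₁ = b₂ ≫ f₂ ∧ c₂ ≫ f₂ = c₃ ≫ f₃ ∧
      m₁ ≫ f₁ = m₂ ≫ f₂ ∧ m₁ ≫ f₁ = m₃ ≫ f₃ ∧
      R (Subobject.mk (a₁ ≫ f₁)) (Subobject.mk f₂) (Subobject.mk (m₁ ≫ f₁))

/-- A simple independence relation. -/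
structure IsSimple : Prop where
  invariance : R.Invariance
  monotonicity : R.Monotonicity
  baseMonotonicity : R.BaseMonotonicity
  transitivity : R.Transitivity
  symmetry : R.Symmetry
  existence : R.Existence
  union : R.Union
  localCharacter : R.LocalCharacter
  threeAmalgamation : R.ThreeAmalgamation

end IndepRel

end AECat

/-! Write `a ⊥_c b` for independence over `c`, and `M_i` for the models of an isi-sequence `(b_i)`.
If `a ⊥_c b` fails, `exists_indep_isi` supplies arbitrarily long isi-sequences of realizations of
the type of `b` over `c` with `b_i ⊥_c M_i`. Suppose a single `a'` realized the type of `a` along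
many of the `b_i`. At an index `l` of large cofinality among these, local character gives `a'
⊥_{M_x} M_l` for all `x < l` close to `l`. Choosing such an `x` with `b_x` among the given members,
`a' ⊥_{M_x} b_x` and `b_x ⊥_c M_x` combine by symmetry and transitivity to `a' ⊥_c b_x`, and
invariance contradicts the assumption. Conversely, let `a ⊥_c b` and let a long isi-sequence be
given. Local character applied to some `b_l` yields `j < l` with `b_l ⊥_{M_j} M_l`, and
isi-invariance spreads this to `b_i ⊥_{M_j} M_i` for `j ≤ i ≤ l`. A copy of `a` is made independent
from `b_j` over the model `M_j`. Then 3-amalgamation at successors and Union at limits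
(`exists_realization`) produce one realization for all `b_i` with `j ≤ i < l`, too many for
isi-dividing. Both constructions are transfinite and rest on
`exists_functor_of_transfinite_extension`. -/

namespace CategoryTheory

open SmallObject SmallObject.SuccStruct

/-! ### Transfinite construction of functors on well-orders. -/

section TransfiniteExtension

variable {K : Type*} [LinearOrder K] {D : Type*} [Category* D]

/-- The restriction of a functor on a set of indices to a smaller set. -/
def restrictSet {S T : Set K} (h : S ⊆ T) (F : T ⥤ D) : S ⥤ D where
  obj k := F.obj ⟨k, h k.2⟩
  map f := F.map (homOfLE (leOfHom f))
  map_id _ := F.map_id _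
  map_comp _ _ := (F.map_comp (homOfLE _) (homOfLE _)).symm ▸ rfl

/-- A functor defined on a lower set of `K`. -/
structure LowerSetFunctor (K : Type*) [LinearOrder K] (D : Type*) [Category* D] where
  dom : Set K
  isLowerSet : IsLowerSet dom
  functor : dom ⥤ D

namespace LowerSetFunctor

/-- The restriction to `Set.Iic i`, for `i` in the domain. -/
def restrictIic (s : LowerSetFunctor K D) (i : K) (hi : i ∈ s.dom) : Set.Iic i ⥤ D :=
  restrictSet (fun _ hk => s.isLowerSet hk hi) s.functor

/-- `t` extends `s`. -/
def Extends (s t : LowerSetFunctor K D) : Prop :=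
  ∃ h : s.dom ⊆ t.dom, restrictSet h t.functor = s.functor

lemma Extends.trans {s t r : LowerSetFunctor K D} (h₁ : s.Extends t) (h₂ : t.Extends r) :
    s.Extends r := by
  obtain ⟨h₁, e₁⟩ := h₁
  obtain ⟨h₂, e₂⟩ := h₂
  refine ⟨h₁.trans h₂, ?_⟩
  rw [← e₁, ← e₂]
  rfl

lemma Extends.restrictIic_eq {s t : LowerSetFunctor K D} (h : s.Extends t) (i : K) (hi : i ∈ s.dom) :
    t.restrictIic i (h.1 hi) = s.restrictIic i hi := by
  exact congrArg (restrictSet fun _ hk => s.isLowerSet hk hi) h.2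

lemma Extends.obj_eq {s t : LowerSetFunctor K D} (h : s.Extends t) (i : K) (hi : i ∈ s.dom) :
    t.functor.obj ⟨i, h.1 hi⟩ = s.functor.obj ⟨i, hi⟩ :=
  Functor.congr_obj h.2 ⟨i, hi⟩

lemma Extends.map_eq {s t : LowerSetFunctor K D} (h : s.Extends t) {i j : K} (hij : i ≤ j)
    (hi : i ∈ s.dom) (hj : j ∈ s.dom) :
    t.functor.map (homOfLE hij : (⟨i, h.1 hi⟩ : t.dom) ⟶ ⟨j, h.1 hj⟩) =
      eqToHom (h.obj_eq i hi) ≫ s.functor.map (homOfLE hij : (⟨i, hi⟩ : s.dom) ⟶ ⟨j, hj⟩) ≫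
        eqToHom (h.obj_eq j hj).symm :=
  Functor.congr_hom h.2 (homOfLE hij : (⟨i, hi⟩ : s.dom) ⟶ ⟨j, hj⟩)

/-- The union of the chain: the value at `i` is read off from a chosen member `σ i` defined at `i`.
Members agree only up to equality of objects, so transition maps carry an `eqToHom`. -/
lemma exists_upper_bound {c : Set (LowerSetFunctor K D)} (hc : IsChain Extends c) :
    ∃ t : LowerSetFunctor K D, t.dom = ⋃ s ∈ c, s.dom ∧ ∀ s ∈ c, s.Extends t := by
  have key : ∀ s ∈ c, ∀ t ∈ c, s.Extends t ∨ t.Extends s := by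
    intro s hs t ht
    by_cases h : s = t
    · subst h
      exact Or.inl ⟨subset_rfl, rfl⟩
    · exact hc hs ht h
  have hobj : ∀ s ∈ c, ∀ t ∈ c, ∀ i (hi : i ∈ s.dom) (hi' : i ∈ t.dom),
      s.functor.obj ⟨i, hi⟩ = t.functor.obj ⟨i, hi'⟩ := by
    intro s hs t ht i hi hi'
    rcases key s hs t ht with h | h
    · exact (h.obj_eq i hi).symm
    · exact h.obj_eq i hi'
  have hmap : ∀ s (hs : s ∈ c) t (ht : t ∈ c) i j (hij : i ≤ j) (hi : i ∈ s.dom) (hi' : i ∈ t.dom)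
      (hj : j ∈ s.dom) (hj' : j ∈ t.dom),
      s.functor.map (homOfLE hij : (⟨i, hi⟩ : s.dom) ⟶ ⟨j, hj⟩) =
        eqToHom (hobj s hs t ht i hi hi') ≫
          t.functor.map (homOfLE hij : (⟨i, hi'⟩ : t.dom) ⟶ ⟨j, hj'⟩) ≫
        eqToHom (hobj s hs t ht j hj hj').symm := by
    intro s hs t ht i j hij hi hi' hj hj'
    rcases key s hs t ht with h | h
    · rw [h.map_eq hij hi hj]
      simp
    · exact h.map_eq hij hi' hj'
  have hex : ∀ i : (⋃ s ∈ c, s.dom : Set K), ∃ s ∈ c, i.1 ∈ s.dom := by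
    rintro ⟨i, hi⟩
    simpa using hi
  choose σ hσ hdom using hex
  have hdom' : ∀ {i j : (⋃ s ∈ c, s.dom : Set K)}, i ≤ j → i.1 ∈ (σ j).dom :=
    fun {i j} h => (σ j).isLowerSet h (hdom j)
  let F : (⋃ s ∈ c, s.dom : Set K) ⥤ D :=
    { obj i := (σ i).functor.obj ⟨i, hdom i⟩
      map {i j} f := eqToHom (hobj (σ i) (hσ i) (σ j) (hσ j) i (hdom i) (hdom' (leOfHom f))) ≫
        (σ j).functor.map (homOfLE (leOfHom f) :
          (⟨i, hdom' (leOfHom f)⟩ : (σ j).dom) ⟶ ⟨j, hdom j⟩)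
      map_id i := by
        simp only [eqToHom_refl, Category.id_comp]
        exact (σ i).functor.map_id _
      map_comp {i j k} f g := by
        rw [hmap (σ j) (hσ j) (σ k) (hσ k) i j (leOfHom f) (hdom' (leOfHom f))
          (hdom' (leOfHom (f ≫ g))) (hdom j) (hdom' (leOfHom g))]
        simp only [Category.assoc, eqToHom_trans_assoc, eqToHom_refl, Category.id_comp]
        rw [← Functor.map_comp]
        rfl }
  refine ⟨⟨_, ?_, F⟩, rfl, fun s hs => ⟨fun i hi => Set.mem_biUnion hs hi, ?_⟩⟩
  · exact isLowerSet_iUnion₂ fun s _ => s.isLowerSet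
  · refine Functor.ext (fun i => hobj _ (hσ _) _ hs _ _ _) fun i j f => ?_
    change eqToHom _ ≫ (σ _).functor.map _ = _
    rw [hmap (σ _) (hσ _) s hs i.1 j.1 (leOfHom f) _ i.2 _ j.2]
    simp
    rfl

end LowerSetFunctor

/-- Zorn's lemma for good functors on lower sets. Goodness at `i` only sees the restriction to
`Set.Iic i`, so it survives unions of chains. A maximal element is defined everywhere: otherwise its
domain is `Set.Iio i` for the least missing `i`, and `ext` enlarges it. -/
theorem exists_functor_forall_restrict [WellFoundedLT K]
    (Good : ∀ i : K, (Set.Iic i ⥤ D) → Prop)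
    (ext : ∀ (i : K) (F : Set.Iio i ⥤ D),
      (∀ k (hk : k < i), Good k (restrictSet (fun _ hl => lt_of_le_of_lt hl hk) F)) →
      ∃ F' : Set.Iic i ⥤ D, restrictSet Set.Iio_subset_Iic_self F' = F ∧ Good i F') :
    ∃ F : K ⥤ D, ∀ i, Good i ((Subtype.mono_coe (· ∈ Set.Iic i)).functor ⋙ F) := by
  let T := {s : LowerSetFunctor K D // ∀ i hi, Good i (s.restrictIic i hi)}
  obtain ⟨m, hm⟩ := exists_maximal_of_chains_bounded (α := T)
    (r := fun s t => s.1.Extends t.1) (fun c hc => by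
      obtain ⟨t, ht, hst⟩ := LowerSetFunctor.exists_upper_bound (c := Subtype.val '' c) (by
        rintro _ ⟨s, hs, rfl⟩ _ ⟨t, ht, rfl⟩ hne
        exact hc hs ht fun h => hne (by rw [h]))
      refine ⟨⟨t, fun i hi => ?_⟩, fun s hs => hst _ ⟨s, hs, rfl⟩⟩
      have : ∃ s ∈ Subtype.val '' c, i ∈ s.dom := by
        rw [ht] at hi
        simpa only [Set.mem_iUnion, exists_prop] using hi
      obtain ⟨_, ⟨s, hs, rfl⟩, his⟩ := this
      have e := (hst _ ⟨s, hs, rfl⟩).restrictIic_eq i his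
      rw [e]
      exact s.2 i his)
    (fun h₁ h₂ => h₁.trans h₂)
  obtain ⟨⟨I, hI, F⟩, hF⟩ := m
  by_cases hu : ∀ i, i ∈ I
  · refine ⟨(Monotone.functor (f := fun i => (⟨i, hu i⟩ : I)) fun _ _ h => h) ⋙ F, fun i => ?_⟩
    exact hF i (hu i)
  · exfalso
    push Not at hu
    obtain ⟨i, hi, hmin⟩ := WellFounded.has_min (wellFounded_lt (α := K)) Iᶜ hu
    obtain rfl : I = Set.Iio i := by
      ext k
      constructor
      · intro hk
        by_contra h
        exact hi (hI (not_lt.1 h) hk)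
      · intro hk
        by_contra h
        exact hmin k h hk
    obtain ⟨F', e, hF'⟩ := ext i F fun k hk => hF k hk
    have hext : ∀ k (hk : k ∈ Set.Iic i), Good k
        ((⟨Set.Iic i, isLowerSet_Iic i, F'⟩ : LowerSetFunctor K D).restrictIic k hk) := by
      intro k hk
      rcases eq_or_lt_of_le (show k ≤ i from hk) with h | h
      · subst h
        exact hF'
      · subst e
        exact hF k h
    have := hm ⟨⟨Set.Iic i, isLowerSet_Iic i, F'⟩, hext⟩ ⟨Set.Iio_subset_Iic_self, e⟩
    exact lt_irrefl i (this.1 (show i ∈ Set.Iic i from le_rfl))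

/-- Transfinite construction of a functor on a well-ordered set, whose values satisfy `Ob`, whose
successor arrows satisfy `W`, and whose composite with `ev` is continuous. -/
theorem exists_functor_of_transfinite_extension [WellFoundedLT K] {E : Type*} [Category* E]
    (ev : D ⥤ E) (Ob : K → D → Prop) (W : MorphismProperty D)
    (hbot : ∀ i, IsMin i → ∃ x, Ob i x)
    (hsucc : ∀ k i, k ⋖ i → ∀ x, Ob k x → ∃ (y : D) (f : x ⟶ y), Ob i y ∧ W f)
    (hlim : ∀ i, Order.IsSuccLimit i → ∀ F : Set.Iio i ⥤ D, (∀ k : Set.Iio i, Ob k.1 (F.obj k)) →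
      ∃ c : Cocone F, Ob i c.pt ∧ Nonempty (IsColimit (ev.mapCocone c))) :
    ∃ F : K ⥤ D, (∀ i, Ob i (F.obj i)) ∧
      (∀ k i (h : k ⋖ i), W (F.map (homOfLE h.le))) ∧ (F ⋙ ev).IsWellOrderContinuous := by
  let Good (i : K) (F : Set.Iic i ⥤ D) : Prop :=
    Ob i (F.obj ⟨i, le_rfl⟩) ∧
    (∀ k (h : k ⋖ i), W (F.map (homOfLE h.le : (⟨k, h.le⟩ : Set.Iic i) ⟶ ⟨i, le_rfl⟩))) ∧
    (Order.IsSuccLimit i → Nonempty (IsColimit (ev.mapCocone (coconeOfLE F (le_refl i)))))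
  obtain ⟨F, hF⟩ := exists_functor_forall_restrict Good (fun i F hF => by
    -- Extending a functor from `Set.Iio i` to `Set.Iic i` amounts to giving a cocone on it.
    suffices ∃ c : Cocone F, Ob i c.pt ∧ (∀ k (h : k ⋖ i), W (c.ι.app ⟨k, h.lt⟩)) ∧
        (Order.IsSuccLimit i → Nonempty (IsColimit (ev.mapCocone c))) by
      obtain ⟨c, h₁, h₂, h₃⟩ := this
      refine ⟨ofCocone c, ?_, ?_, ?_, ?_⟩
      · refine Functor.ext (fun k => ofCocone_obj_eq c k.1 k.2) fun k l f => ?_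
        exact ofCocone_map c k.1 l.1 (leOfHom f) l.2
      · rw [ofCocone_obj_eq_pt]
        exact h₁
      · intro k h
        have e : Arrow.mk ((ofCocone c).map
          (homOfLE h.le : (⟨k, h.le⟩ : Set.Iic i) ⟶ ⟨i, le_rfl⟩)) = Arrow.mk (c.ι.app ⟨k, h.lt⟩) :=
          arrowMap_ofCocone_to_top c k h.lt
        rw [← W.arrow_mk_mem_toSet_iff, e]
        exact h₂ k h
      · intro hi
        obtain ⟨hc⟩ := h₃ hi
        exact ⟨(IsColimit.precomposeInvEquiv
          (Functor.isoWhiskerRight (restrictionLTOfCoconeIso c) ev) _).1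
          (IsColimit.ofIsoColimit hc (Cocone.ext (ev.mapIso (ofCoconeObjIsoPt c).symm)
            (fun ⟨k, hk⟩ => by
              change ev.map (c.ι.app ⟨k, hk⟩) ≫ ev.map (ofCoconeObjIsoPt c).inv =
                ev.map (ofCoconeObjIso c k hk).inv ≫ ev.map ((ofCocone c).map
                  (homOfLE (le_of_lt hk) : (⟨k, le_of_lt hk⟩ : Set.Iic i) ⟶ ⟨i, le_rfl⟩))
              rw [ofCocone_map_to_top _ _ hk, ← ev.map_comp, ← ev.map_comp,
                Iso.inv_hom_id_assoc])))⟩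
    by_cases hmin : IsMin i
    · obtain ⟨x, hx⟩ := hbot i hmin
      have : IsEmpty (Set.Iio i) := ⟨fun k => hmin.not_lt k.2⟩
      exact ⟨⟨x, { app := fun k => isEmptyElim k, naturality := fun k => isEmptyElim k }⟩, hx,
        fun k h => (hmin.not_lt h.lt).elim, fun h => (h.1 hmin).elim⟩
    by_cases hpre : Order.IsSuccPrelimit i
    · obtain ⟨c, h₁, h₂⟩ := hlim i ⟨hmin, hpre⟩ F fun k => (hF k.1 k.2).1
      exact ⟨c, h₁, fun k h => (hpre k h).elim, fun _ => h₂⟩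
    · obtain ⟨k, hk⟩ := Order.not_isSuccPrelimit_iff.1 hpre
      have hk' : k ∈ Set.Iio i := hk.lt
      obtain ⟨y, f, hy, hf⟩ : ∃ (y : D) (f : F.obj ⟨k, hk'⟩ ⟶ y), Ob i y ∧ W f :=
        hsucc k i hk _ (hF k hk.lt).1
      -- The predecessor `k` is the greatest element of `Set.Iio i`, so `f` alone determines the
      -- cocone.
      have hle : ∀ l : Set.Iio i, l ≤ ⟨k, hk'⟩ := fun l => hk.le_of_lt l.2
      refine ⟨⟨y, { app := fun l => F.map (homOfLE (hle l)) ≫ f, naturality := fun l l' g => ?_ }⟩,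
        hy, fun l h => ?_, fun h => (h.2 k hk).elim⟩
      · dsimp
        rw [← F.map_comp_assoc, Category.comp_id]
        rfl
      · obtain rfl : l = k := h.unique_left hk
        change W (F.map (𝟙 _) ≫ f)
        rw [F.map_id, Category.id_comp]
        exact hf)
  refine ⟨F, fun i => (hF i).1, fun k i h => (hF i).2.1 k h, ⟨fun i hi => (hF i).2.2 hi⟩⟩

end TransfiniteExtension

end CategoryTheory

/-! ### Calculus of Galois types and of independence for arrows. -/

namespace AECat

variable {𝒦 : AECat.{v, u}}

section GaloisTypes

variable {X Y Z W : 𝒦.Obj} {M M' M'' N : 𝒦.Model}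

@[simp]
lemma push_mk {X Y A : 𝒦.Obj} (f : X ⟶ Y) (a : A ⟶ X) :
    push f (Subobject.mk a) = Subobject.mk (a ≫ f) :=
  Subobject.map_mk a f

lemma GtpEq₂.of_hom (x : X ⟶ M.obj) (y : Y ⟶ M.obj) (f : M.obj ⟶ N.obj) :
    GtpEq₂ x y (x ≫ f) (y ≫ f) :=
  ⟨N, f, 𝟙 _, by simp, by simp⟩

lemma GtpEq₂.symm {x : X ⟶ M.obj} {y : Y ⟶ M.obj} {x' : X ⟶ M'.obj} {y' : Y ⟶ M'.obj}
    (h : GtpEq₂ x y x' y') : GtpEq₂ x' y' x y := by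
  obtain ⟨N, f, g, h₁, h₂⟩ := h
  exact ⟨N, g, f, h₁.symm, h₂.symm⟩

/-- The two witnessing models are amalgamated over the middle one. -/
lemma GtpEq₂.trans (hAP : 𝒦.AmalgamationProperty)
    {x : X ⟶ M.obj} {y : Y ⟶ M.obj} {x' : X ⟶ M'.obj} {y' : Y ⟶ M'.obj}
    {x'' : X ⟶ M''.obj} {y'' : Y ⟶ M''.obj}
    (h : GtpEq₂ x y x' y') (h' : GtpEq₂ x' y' x'' y'') : GtpEq₂ x y x'' y'' := by
  obtain ⟨N, f, g, h₁, h₂⟩ := h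
  obtain ⟨N', f', g', h₁', h₂'⟩ := h'
  obtain ⟨U, p, q, e⟩ := hAP M' N N' g f'
  refine ⟨U, f ≫ p, g' ≫ q, ?_, ?_⟩
  · rw [reassoc_of% h₁, e, reassoc_of% h₁']
  · rw [reassoc_of% h₂, e, reassoc_of% h₂']

lemma GtpEq₂.precomp {x : X ⟶ M.obj} {y : Y ⟶ M.obj} {x' : X ⟶ M'.obj} {y' : Y ⟶ M'.obj}
    (h : GtpEq₂ x y x' y') (t : Z ⟶ Y) : GtpEq₂ x (t ≫ y) x' (t ≫ y') := by
  obtain ⟨N, f, g, h₁, h₂⟩ := h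
  exact ⟨N, f, g, h₁, by rw [Category.assoc, h₂, Category.assoc]⟩

lemma GtpEq₃.of_hom (x : X ⟶ M.obj) (y : Y ⟶ M.obj) (z : Z ⟶ M.obj) (f : M.obj ⟶ N.obj) :
    GtpEq₃ x y z (x ≫ f) (y ≫ f) (z ≫ f) :=
  ⟨N, f, 𝟙 _, by simp, by simp, by simp⟩

lemma GtpEq₃.symm {x : X ⟶ M.obj} {y : Y ⟶ M.obj} {z : Z ⟶ M.obj}
    {x' : X ⟶ M'.obj} {y' : Y ⟶ M'.obj} {z' : Z ⟶ M'.obj}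
    (h : GtpEq₃ x y z x' y' z') : GtpEq₃ x' y' z' x y z := by
  obtain ⟨N, f, g, h₁, h₂, h₃⟩ := h
  exact ⟨N, g, f, h₁.symm, h₂.symm, h₃.symm⟩

lemma GtpEq₃.trans (hAP : 𝒦.AmalgamationProperty)
    {x : X ⟶ M.obj} {y : Y ⟶ M.obj} {z : Z ⟶ M.obj}
    {x' : X ⟶ M'.obj} {y' : Y ⟶ M'.obj} {z' : Z ⟶ M'.obj}
    {x'' : X ⟶ M''.obj} {y'' : Y ⟶ M''.obj} {z'' : Z ⟶ M''.obj}
    (h : GtpEq₃ x y z x' y' z') (h' : GtpEq₃ x' y' z' x'' y'' z'') :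
    GtpEq₃ x y z x'' y'' z'' := by
  obtain ⟨N, f, g, h₁, h₂, h₃⟩ := h
  obtain ⟨N', f', g', h₁', h₂', h₃'⟩ := h'
  obtain ⟨U, p, q, e⟩ := hAP M' N N' g f'
  refine ⟨U, f ≫ p, g' ≫ q, ?_, ?_, ?_⟩
  · rw [reassoc_of% h₁, e, reassoc_of% h₁']
  · rw [reassoc_of% h₂, e, reassoc_of% h₂']
  · rw [reassoc_of% h₃, e, reassoc_of% h₃']

lemma GtpEq₃.precomp {x : X ⟶ M.obj} {y : Y ⟶ M.obj} {z : Z ⟶ M.obj}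
    {x' : X ⟶ M'.obj} {y' : Y ⟶ M'.obj} {z' : Z ⟶ M'.obj}
    (h : GtpEq₃ x y z x' y' z') (t : W ⟶ Z) : GtpEq₃ x y (t ≫ z) x' y' (t ≫ z') := by
  obtain ⟨N, f, g, h₁, h₂, h₃⟩ := h
  exact ⟨N, f, g, h₁, h₂, by rw [Category.assoc, h₃, Category.assoc]⟩

end GaloisTypes

/-- The independence relation on arrows. -/
abbrev IndepRel.Arr (R : IndepRel 𝒦) {X Y Z : 𝒦.Obj} {M : 𝒦.Model}
    (a : X ⟶ M.obj) (b : Y ⟶ M.obj) (c : Z ⟶ M.obj) : Prop :=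
  R (Subobject.mk a) (Subobject.mk b) (Subobject.mk c)

namespace IndepRel.IsSimple

variable {R : IndepRel 𝒦} {X Y Z W : 𝒦.Obj} {M M' N : 𝒦.Model}

lemma of_gtpEq (hR : R.IsSimple) {a : X ⟶ M.obj} {b : Y ⟶ M.obj} {c : Z ⟶ M.obj}
    {a' : X ⟶ M'.obj} {b' : Y ⟶ M'.obj} {c' : Z ⟶ M'.obj}
    (h : R.Arr a b c) (e : GtpEq₃ a b c a' b' c') : R.Arr a' b' c' := by
  obtain ⟨N, f, g, h₁, h₂, h₃⟩ := e
  exact hR.invariance _ _ _ _ _ _ h ⟨N, f, g, by simp [h₁], by simp [h₂], by simp [h₃]⟩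

lemma comp_iff (hR : R.IsSimple) (a : X ⟶ M.obj) (b : Y ⟶ M.obj) (c : Z ⟶ M.obj)
    (f : M.obj ⟶ N.obj) : R.Arr (a ≫ f) (b ≫ f) (c ≫ f) ↔ R.Arr a b c :=
  ⟨fun h => hR.of_gtpEq h (GtpEq₃.of_hom a b c f).symm,
    fun h => hR.of_gtpEq h (GtpEq₃.of_hom a b c f)⟩

lemma mono_right (hR : R.IsSimple) {a : X ⟶ M.obj} {b : Y ⟶ M.obj} {c : Z ⟶ M.obj}
    (h : R.Arr a b c) (t : W ⟶ Y) : R.Arr a (t ≫ b) c :=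
  hR.monotonicity _ _ _ _ h (Subobject.mk_le_mk_of_comm t rfl)

lemma base_mono (hR : R.IsSimple) {a : X ⟶ M.obj} {b : Y ⟶ M.obj} {c : Z ⟶ M.obj}
    {d : W ⟶ M.obj} (h : R.Arr a b c) (s : Z ⟶ W) (hs : s ≫ d = c) (t : W ⟶ Y) (ht : t ≫ b = d) :
    R.Arr a b d :=
  hR.baseMonotonicity _ _ _ _ h (Subobject.mk_le_mk_of_comm s hs) (Subobject.mk_le_mk_of_comm t ht)

lemma trans_arr (hR : R.IsSimple) {a : X ⟶ M.obj} {b : Y ⟶ M.obj} {c : Z ⟶ M.obj}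
    {d : W ⟶ M.obj} (h₁ : R.Arr a b c) (h₂ : R.Arr a d b) (s : Z ⟶ Y) (hs : s ≫ b = c) :
    ∃ (N : 𝒦.Model) (f : M.obj ⟶ N.obj) (V : 𝒦.Obj) (e : V ⟶ N.obj), R.Arr (a ≫ f) e (c ≫ f) ∧
      (∃ p, p ≫ e = b ≫ f) ∧ (∃ p, p ≫ e = d ≫ f) := by
  obtain ⟨N, f, E, h, hb, hd⟩ := hR.transitivity _ _ _ _ h₁ h₂ (Subobject.mk_le_mk_of_comm s hs)
  simp only [push_mk] at h hb hd
  refine ⟨N, f, _, E.arrow, ?_, ⟨Subobject.ofMkLE _ _ hb, by simp⟩,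
    ⟨Subobject.ofMkLE _ _ hd, by simp⟩⟩
  rw [Arr, Subobject.mk_arrow]
  exact h

/-- Transitivity only provides some `E` above `d` in an extension; monotonicity cuts it down to `d`,
and independence does not depend on the ambient model. -/
lemma trans_right (hR : R.IsSimple) {a : X ⟶ M.obj} {b : Y ⟶ M.obj} {c : Z ⟶ M.obj}
    {d : W ⟶ M.obj} (h₁ : R.Arr a b c) (h₂ : R.Arr a d b) (s : Z ⟶ Y) (hs : s ≫ b = c) :
    R.Arr a d c := by
  obtain ⟨N, f, V, e, h, -, p, hp⟩ := hR.trans_arr h₁ h₂ s hs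
  rw [← hR.comp_iff a d c f, ← hp]
  exact hR.mono_right h p

lemma exists_indep (hR : R.IsSimple) (a : X ⟶ M.obj) (b : Y ⟶ M.obj) (c : Z ⟶ M.obj) :
    ∃ (N : 𝒦.Model) (f : M.obj ⟶ N.obj) (a' : X ⟶ N.obj),
      R.Arr a' (b ≫ f) (c ≫ f) ∧ GtpEq₂ a' (c ≫ f) a c := by
  obtain ⟨N, f, a', h, e⟩ := hR.existence a c (Subobject.mk b)
  rw [push_mk] at h
  exact ⟨N, f, a', h, e⟩

/-- Existence with `b = c` gives this for a copy of `a` of the same type over `c`. -/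
lemma indep_base (hR : R.IsSimple) (a : X ⟶ M.obj) (c : Z ⟶ M.obj) : R.Arr a c c := by
  obtain ⟨N, f, a', h, g⟩ := hR.exists_indep a c c
  obtain ⟨U, p, q, h₁, h₂⟩ := g
  exact hR.of_gtpEq h ⟨U, p, q, h₁, h₂, h₂⟩

/-- Existence makes a copy `a'` independent from `d` over `b`. Since `c` factors through `b`, the
copy inherits `a' ⊥_c b`, and transitivity applies. -/
lemma exists_extension_of_base_le (hR : R.IsSimple) {a : X ⟶ M.obj} {b : Y ⟶ M.obj}
    {c : Z ⟶ M.obj} (h : R.Arr a b c) (s : Z ⟶ Y) (hs : s ≫ b = c) (d : W ⟶ M.obj) :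
    ∃ (N : 𝒦.Model) (f : M.obj ⟶ N.obj) (a' : X ⟶ N.obj),
      GtpEq₂ a' (b ≫ f) a b ∧ R.Arr a' (d ≫ f) (c ≫ f) := by
  obtain ⟨N, f, a', h', g⟩ := hR.exists_indep a d b
  refine ⟨N, f, a', g, ?_⟩
  have h'' : R.Arr a' (b ≫ f) (c ≫ f) := by
    obtain ⟨U, p, q, h₁, h₂⟩ := g
    refine hR.of_gtpEq h ⟨U, q, p, h₁.symm, h₂.symm, ?_⟩
    rw [← hs, Category.assoc, Category.assoc, Category.assoc, ← h₂, Category.assoc]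
  exact hR.trans_right h'' h' s (by rw [reassoc_of% hs])

/-- Without `c ≤ b`, Transitivity applied to `a ⊥_c c` and `a ⊥_c b` first enlarges `b` to some `E`
containing both `b` and `c`, still independent from `a` over `c`. -/
lemma exists_extension (hR : R.IsSimple) {a : X ⟶ M.obj} {b : Y ⟶ M.obj} {c : Z ⟶ M.obj}
    (h : R.Arr a b c) (d : W ⟶ M.obj) :
    ∃ (N : 𝒦.Model) (f : M.obj ⟶ N.obj) (a' : X ⟶ N.obj),
      GtpEq₃ a' (b ≫ f) (c ≫ f) a b c ∧ R.Arr a' (d ≫ f) (c ≫ f) := by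
  obtain ⟨N, f, V, e, he, ⟨s, hs⟩, ⟨t, ht⟩⟩ :=
    hR.trans_arr (hR.indep_base a c) h (𝟙 _) (Category.id_comp _)
  obtain ⟨N', g, a', ⟨U, p, q, h₁, h₂⟩, h'⟩ := hR.exists_extension_of_base_le he s hs (d ≫ f)
  refine ⟨N', f ≫ g, a', ⟨U, p, f ≫ q, ?_, ?_, ?_⟩, by simpa using h'⟩
  · rw [h₁, Category.assoc]
  · rw [← reassoc_of% ht, Category.assoc, ← reassoc_of% ht, ← h₂, Category.assoc]
  · rw [← reassoc_of% hs, Category.assoc, ← reassoc_of% hs, ← h₂, Category.assoc]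

end IndepRel.IsSimple
end AECat

/-! ### Indices of large cofinality in a regular cardinal. -/

/-- A subset of size at least `κ` of the ordinals below a regular `θ > κ` is cofinal, with
cofinality at least `κ`, below some `l < θ`. -/
lemma Cardinal.IsRegular.exists_forall_bounded_below {θ κ : Cardinal.{v}} (hθ : θ.IsRegular)
    (hκ : κ.IsRegular) (hlt : κ < θ) (I : Set θ.ord.ToType) (hI : κ ≤ Cardinal.mk I) :
    ∃ l : θ.ord.ToType, ∀ s : Set θ.ord.ToType, s ⊆ Set.Iio l → Cardinal.mk s < κ →
      ∃ x ∈ I, x < l ∧ ∀ y ∈ s, y < x := by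
  have := Cardinal.noMaxOrder hθ.aleph0_le
  -- The index `l` sought is the least one with at least `κ` elements of `I` below it. One exists
  -- because a subset of `I` of size exactly `κ < θ` is bounded.
  have hex : {l | κ ≤ Cardinal.mk (I ∩ Set.Iio l : Set θ.ord.ToType)}.Nonempty := by
    obtain ⟨I₀, hI₀, hc⟩ := Cardinal.le_mk_iff_exists_subset.1 hI
    have hb : ∃ l, ∀ y ∈ I₀, y < l := by
      by_contra! h
      have : Order.cof θ.ord.ToType ≤ Cardinal.mk I₀ := Order.cof_le h
      rw [Ordinal.cof_toType, hθ.cof_ord, hc] at this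
      exact hlt.not_ge this
    obtain ⟨l, hl⟩ := hb
    refine ⟨l, hc.ge.trans (Cardinal.mk_le_mk_of_subset fun y hy => ⟨hI₀ hy, hl y hy⟩)⟩
  obtain ⟨l, hl, hmin⟩ := WellFounded.has_min (wellFounded_lt (α := θ.ord.ToType)) _ hex
  refine ⟨l, fun s hs hsc => ?_⟩
  by_contra! h
  -- If `s` were a counterexample, fewer than `κ` pieces would cover `I` below `l`, each of size
  -- less than `κ` by minimality of `l`; this contradicts regularity.
  have hsub : I ∩ Set.Iio l ⊆ ⋃ y : s, I ∩ Set.Iio (Order.succ y.1) := by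
    rintro x ⟨hx, hxl⟩
    obtain ⟨y, hy, hxy⟩ := h x hx hxl
    exact Set.mem_iUnion.2 ⟨⟨y, hy⟩, hx, Order.lt_succ_of_le hxy⟩
  have hy : ∀ y : s, Cardinal.mk (I ∩ Set.Iio (Order.succ y.1) : Set θ.ord.ToType) < κ := by
    intro y
    have h₁ : Cardinal.mk (I ∩ Set.Iio y.1 : Set θ.ord.ToType) < κ :=
      not_le.1 fun h => hmin y.1 h (hs y.2)
    refine (Cardinal.mk_le_mk_of_subset (t := (I ∩ Set.Iio y.1) ∪ {y.1}) ?_).trans_lt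
      ((Cardinal.mk_union_le _ _).trans_lt (Cardinal.add_lt_of_lt hκ.aleph0_le h₁ ?_))
    · rintro x ⟨hx, hxy⟩
      rcases (Order.lt_succ_iff.1 (Set.mem_Iio.1 hxy)).lt_or_eq with h | h
      · exact Or.inl ⟨hx, h⟩
      · exact Or.inr h
    · rw [Cardinal.mk_singleton]
      exact Cardinal.one_lt_aleph0.trans_le hκ.aleph0_le
  refine hl.not_gt ((Cardinal.mk_le_mk_of_subset hsub).trans_lt
    ((Cardinal.mk_iUnion_le_sum_mk).trans_lt ?_))
  exact Cardinal.sum_lt_of_isRegular hκ hsc hy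

/-- The empty set shows that `l` is not minimal, and singletons that it has no predecessor. -/
lemma Order.isSuccLimit_of_forall_bounded {K : Type v} [LinearOrder K] {κ : Cardinal.{v}}
    (hκ : Cardinal.aleph0 ≤ κ) {l : K} (h : ∀ s : Set K, s ⊆ Set.Iio l → Cardinal.mk s < κ →
      ∃ x < l, ∀ y ∈ s, y < x) : Order.IsSuccLimit l := by
  constructor
  · intro hl
    obtain ⟨x, hx, -⟩ := h ∅ (Set.empty_subset _)
      (by simpa using Cardinal.aleph0_pos.trans_le hκ)
    exact hl.not_lt hx
  · intro k hk
    obtain ⟨x, hx, hkx⟩ := h {k} (by simpa using hk.lt)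
      (by simpa using Cardinal.one_lt_aleph0.trans_le hκ)
    exact hk.2 (hkx k rfl) hx

lemma CategoryTheory.isCardinalFiltered_Iio_of_forall_bounded {K : Type v} [LinearOrder K]
    {κ : Cardinal.{v}} [Fact κ.IsRegular] {l : K}
    (h : ∀ s : Set K, s ⊆ Set.Iio l → Cardinal.mk s < κ → ∃ x < l, ∀ y ∈ s, y < x) :
    IsCardinalFiltered (Set.Iio l) κ :=
  isCardinalFiltered_preorder _ _ fun J s hJ => by
    obtain ⟨x, hx, hs⟩ := h (Set.range fun j => (s j).1) (by rintro _ ⟨j, rfl⟩; exact (s j).2)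
      (Cardinal.mk_range_le.trans_lt hJ)
    exact ⟨⟨x, hx⟩, fun j => (hs _ ⟨j, rfl⟩).le⟩

/-! ### Local character along chains. -/

namespace AECat

variable {𝒦 : AECat.{v, u}}

namespace IndepRel.IsSimple

variable {R : IndepRel 𝒦}

/-- Every object of an accessible category is presentable, so local character yields a bound `Υ`
that depends on `X` only, not on the model or the arrows. -/
lemma exists_presentable_base (hR : R.IsSimple) (X : 𝒦.Obj) :
    ∃ (Υ : Cardinal.{v}) (_ : Fact Υ.IsRegular), ∀ {N : 𝒦.Model} {Y : 𝒦.Obj} (a : X ⟶ N.obj)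
      (b : Y ⟶ N.obj), ∃ (W : 𝒦.Obj) (w : W ⟶ Y), IsCardinalPresentable W Υ ∧
        R.Arr a b (w ≫ b) := by
  have := 𝒦.accessible
  obtain ⟨κ, hκ, hX⟩ : ∃ (κ : Cardinal.{v}) (_ : Fact κ.IsRegular), IsCardinalPresentable X κ :=
    (inferInstance : IsPresentable.{v} X).exists_cardinal
  obtain ⟨Υ, hΥ, h⟩ := hR.localCharacter κ
  refine ⟨Υ, hΥ, fun {N Y} a b => ?_⟩
  obtain ⟨B', hle, hp, hB⟩ := h (Subobject.mk a) (Subobject.mk b)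
    (isCardinalPresentable_of_iso (Subobject.underlyingIso a).symm κ)
  refine ⟨B', Subobject.ofLEMk _ _ hle, hp, ?_⟩
  rw [Arr, Subobject.ofLEMk_comp, Subobject.mk_arrow]
  exact hB

/-- Local character along a continuous chain of large cofinality. -/
lemma exists_indep_of_chain (hR : R.IsSimple) {X : 𝒦.Obj} {Υ κ : Cardinal.{v}} [Fact Υ.IsRegular]
    [Fact κ.IsRegular] (hΥκ : Υ ≤ κ)
    (hΥ : ∀ {N : 𝒦.Model} {Y : 𝒦.Obj} (a : X ⟶ N.obj) (b : Y ⟶ N.obj),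
      ∃ (W : 𝒦.Obj) (w : W ⟶ Y), IsCardinalPresentable W Υ ∧ R.Arr a b (w ≫ b))
    {K : Type v} [LinearOrder K] (F : K ⥤ 𝒦.Obj) [F.IsWellOrderContinuous] {N : 𝒦.Model}
    (m : F ⟶ (Functor.const K).obj N.obj) {l : K}
    (hl : ∀ s : Set K, s ⊆ Set.Iio l → Cardinal.mk s < κ → ∃ x < l, ∀ y ∈ s, y < x)
    (a : X ⟶ N.obj) :
    ∃ k < l, ∀ x, k ≤ x → x < l → R.Arr a (m.app l) (m.app x) := by
  have hlim := Order.isSuccLimit_of_forall_bounded (Fact.out : κ.IsRegular).aleph0_le hl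
  have := isCardinalFiltered_Iio_of_forall_bounded hl
  obtain ⟨W, w, hW, h⟩ := hΥ a (m.app l)
  have := isCardinalPresentable_of_le W hΥκ
  -- `F.obj l` is a `κ`-filtered colimit of the earlier objects, so the small base `W` already maps
  -- to some `F.obj k`; base monotonicity then handles every later index.
  obtain ⟨⟨k, hk⟩, w', hw'⟩ := IsCardinalPresentable.exists_hom_of_isColimit κ
    (F.isColimitOfIsWellOrderContinuous l hlim) w
  have hk : k < l := hk
  change W ⟶ F.obj k at w'
  change w' ≫ F.map (homOfLE hk.le) = w at hw'
  have nat : ∀ {i j : K} (hij : i ≤ j), F.map (homOfLE hij) ≫ m.app j = m.app i := by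
    intro i j hij
    simp
  refine ⟨k, hk, fun x hkx hxl => hR.base_mono h (w' ≫ F.map (homOfLE hkx)) ?_
    (F.map (homOfLE hxl.le)) (nat _)⟩
  rw [← hw', Category.assoc, Category.assoc, nat, nat]

end IndepRel.IsSimple
end AECat

/-! ### Construction of long independent isi-sequences. -/

namespace AECat

variable {𝒦 : AECat.{v, u}}

/-- Directed systems of models have a colimit in the ambient category which is a model. -/
lemma exists_model_colimit {J : Type v} [PartialOrder J] [IsDirectedOrder J] [Nonempty J]
    (F : J ⥤ 𝒦.Obj) (hF : ∀ j, 𝒦.IsModel (F.obj j)) :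
    ∃ (U : 𝒦.Model) (i : F ⟶ (Functor.const J).obj U.obj),
      Nonempty (IsColimit (Cocone.mk U.obj i)) := by
  have := 𝒦.hasDirectedColimits J
  have := 𝒦.preservesDirectedColimits J
  let G : J ⥤ 𝒦.Model := 𝒦.IsModel.lift F hF
  exact ⟨colimit G, 
    { app j := (colimit.ι G j).hom
      naturality j k f :=
      congrArg (fun g => g.hom) ((colimit.cocone G).ι.naturality f) },
    ⟨isColimitOfPreserves 𝒦.IsModel.ι (colimit.isColimit G)⟩⟩

namespace IndepRel

variable (R : IndepRel 𝒦) {Y Z : 𝒦.Obj} {M : 𝒦.Model} (b₀ : Y ⟶ M.obj) (c₀ : Z ⟶ M.obj)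

/-- An extension `m : base ⟶ top` together with a realization `b` in `top` of the Galois type of
`b₀` over `c₀` that is independent from `base` over `c`. -/
structure IndepExt where
  base : 𝒦.Model
  top : 𝒦.Model
  m : base.obj ⟶ top.obj
  b : Y ⟶ top.obj
  c : Z ⟶ base.obj
  indep : R.Arr b m (c ≫ m)
  gtp : GtpEq₂ b (c ≫ m) b₀ c₀

namespace IndepExt

variable {R b₀ c₀}

/-- Morphisms of extensions with an independent realization. -/
@[ext]
structure Hom (s t : R.IndepExt b₀ c₀) where
  base : s.base.obj ⟶ t.base.obj
  top : s.top.obj ⟶ t.top.obj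
  comm : s.m ≫ top = base ≫ t.m
  b_top : s.b ≫ top = t.b
  c_base : s.c ≫ base = t.c

instance : Category (R.IndepExt b₀ c₀) where
  Hom := Hom
  id s := ⟨𝟙 _, 𝟙 _, by simp, by simp, by simp⟩
  comp f g := ⟨f.base ≫ g.base, f.top ≫ g.top, by
    rw [reassoc_of% f.comm, g.comm, Category.assoc], by
    rw [reassoc_of% f.b_top, g.b_top], by rw [reassoc_of% f.c_base, g.c_base]⟩
  id_comp f := Hom.ext (Category.id_comp _) (Category.id_comp _)
  comp_id f := Hom.ext (Category.comp_id _) (Category.comp_id _)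
  assoc f g h := Hom.ext (Category.assoc _ _ _) (Category.assoc _ _ _)

/-- The functor sending an extension to its base. -/
def baseFunctor : R.IndepExt b₀ c₀ ⥤ 𝒦.Obj where
  obj s := s.base.obj
  map f := f.base

/-- The functor sending an extension to its codomain. -/
def topFunctor : R.IndepExt b₀ c₀ ⥤ 𝒦.Obj where
  obj s := s.top.obj
  map f := f.top

/-- The arrows of the extensions form a natural transformation. -/
def mTrans : (baseFunctor : R.IndepExt b₀ c₀ ⥤ 𝒦.Obj) ⟶ topFunctor where
  app s := s.m
  naturality _ _ f := f.comm.symm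

lemma exists_initial (hR : R.IsSimple) : Nonempty (R.IndepExt b₀ c₀) := by
  obtain ⟨N, f, b, h, g⟩ := hR.exists_indep b₀ (𝟙 M.obj) c₀
  rw [Category.id_comp] at h
  exact ⟨⟨M, N, f, b, c₀, h, g⟩⟩

/-- The old top becomes the new base. The new realization is independent from all of it and has the
type of `s.b` over the old base; the witness `U` of this equality of types is the new top, where `q`
sends `s.b` to the new realization. -/
lemma exists_succ (hAP : 𝒦.AmalgamationProperty) (hR : R.IsSimple) (s : R.IndepExt b₀ c₀) :
    ∃ (t : R.IndepExt b₀ c₀) (f : s ⟶ t) (e : s.top.obj ⟶ t.base.obj), s.m ≫ e = f.base := by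
  obtain ⟨N, f, b', ⟨U, p, q, h₁, h₂⟩, h⟩ :=
    hR.exists_extension_of_base_le s.indep s.c rfl (𝟙 s.top.obj)
  have hc : (s.c ≫ s.m) ≫ f ≫ p = s.c ≫ s.m ≫ q := by
    rw [← h₂, Category.assoc, Category.assoc]
  refine ⟨⟨s.top, U, f ≫ p, s.b ≫ q, s.c ≫ s.m, ?_, ?_⟩, ⟨s.m, q, ?_, rfl, rfl⟩, 𝟙 _,
    Category.comp_id _⟩
  · rw [← hR.comp_iff _ _ _ p, Category.id_comp, h₁, Category.assoc] at h
    exact h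
  · rw [hc, ← Category.assoc]
    exact (GtpEq₂.of_hom _ _ q).symm.trans hAP s.gtp
  · exact h₂.symm.trans (Category.assoc _ _ _)

/-- Independence at the limit is Union, which needs the new base to be the colimit of the bases. The
top only has to receive a cocone. -/
lemma exists_cocone (hAP : 𝒦.AmalgamationProperty) (hR : R.IsSimple) {J : Type v} [PartialOrder J] [IsDirectedOrder J]
    [Nonempty J] (F : J ⥤ R.IndepExt b₀ c₀) :
    ∃ c : Cocone F, Nonempty (IsColimit (baseFunctor.mapCocone c)) := by
  obtain ⟨U, i, ⟨hi⟩⟩ := exists_model_colimit (F ⋙ baseFunctor) fun j => (F.obj j).base.property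
  obtain ⟨V, k, -⟩ := exists_model_colimit (F ⋙ topFunctor) fun j => (F.obj j).top.property
  let m : U.obj ⟶ V.obj := hi.desc ⟨V.obj, Functor.whiskerLeft F mTrans ≫ k⟩
  let i' : ∀ j, (F.obj j).base.obj ⟶ U.obj := i.app
  let k' : ∀ j, (F.obj j).top.obj ⟶ V.obj := k.app
  have hm : ∀ j, i' j ≫ m = (F.obj j).m ≫ k' j := hi.fac _
  have hi' : ∀ {j j' : J} (f : j ⟶ j'), (F.map f).base ≫ i' j' = i' j :=
    fun f => (i.naturality f).trans (Category.comp_id _)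
  have hk' : ∀ {j j' : J} (f : j ⟶ j'), (F.map f).top ≫ k' j' = k' j :=
    fun f => (k.naturality f).trans (Category.comp_id _)
  obtain ⟨j₀⟩ := ‹Nonempty J›
  have hb : ∀ j, (F.obj j).b ≫ k' j = (F.obj j₀).b ≫ k' j₀ := by
    intro j
    obtain ⟨l, h, h₀⟩ := exists_ge_ge j j₀
    rw [← hk' (homOfLE h), ← hk' (homOfLE h₀), reassoc_of% (F.map (homOfLE h)).b_top,
      reassoc_of% (F.map (homOfLE h₀)).b_top]
  have hc : ∀ j, (F.obj j).c ≫ i' j = (F.obj j₀).c ≫ i' j₀ := by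
    intro j
    obtain ⟨l, h, h₀⟩ := exists_ge_ge j j₀
    rw [← hi' (homOfLE h), ← hi' (homOfLE h₀), reassoc_of% (F.map (homOfLE h)).c_base,
      reassoc_of% (F.map (homOfLE h₀)).c_base]
  let t : R.IndepExt b₀ c₀ :=
    { base := U
      top := V
      m := m
      b := (F.obj j₀).b ≫ k' j₀
      c := (F.obj j₀).c ≫ i' j₀
      indep := by
        have : Nonempty J := ⟨j₀⟩
        refine hR.union J (F ⋙ baseFunctor) _ hi m _ _ fun j => ?_
        have := (hR.comp_iff _ _ _ (k' j)).2 (F.obj j).indep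
        rw [hb, ← hm, Category.assoc, ← hm, reassoc_of% hc j, ← Category.assoc] at this
        exact this
      gtp := by
        rw [Category.assoc, hm, ← Category.assoc]
        exact (GtpEq₂.of_hom _ _ _).symm.trans hAP (F.obj j₀).gtp }
  refine ⟨⟨t, { app j := ⟨i' j, k' j, (hm j).symm, hb j, hc j⟩, naturality := ?_ }⟩, ⟨?_⟩⟩
  · intro j j' f
    refine Hom.ext ?_ ?_
    · exact (hi' f).trans (Category.comp_id _).symm
    · exact (hk' f).trans (Category.comp_id _).symm
  · exact hi

lemma exists_chain (hAP : 𝒦.AmalgamationProperty) (hR : R.IsSimple) (b₀ : Y ⟶ M.obj)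
    (c₀ : Z ⟶ M.obj) (K : Type v) [LinearOrder K] [WellFoundedLT K] :
    ∃ F : K ⥤ R.IndepExt b₀ c₀, (F ⋙ baseFunctor).IsWellOrderContinuous ∧
      ∀ k i (h : k ⋖ i), ∃ e : (F.obj k).top.obj ⟶ (F.obj i).base.obj,
        (F.obj k).m ≫ e = (F.map (homOfLE h.le)).base := by
  obtain ⟨F, -, hs, hc⟩ := exists_functor_of_transfinite_extension (K := K)
    (baseFunctor : R.IndepExt b₀ c₀ ⥤ 𝒦.Obj) (fun _ _ => True)
    (fun s t f => ∃ e : s.top.obj ⟶ t.base.obj, s.m ≫ e = f.base)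
    (fun _ _ => (exists_initial hR).elim fun s => ⟨s, trivial⟩)
    (fun _ _ _ s _ => by
      obtain ⟨t, f, e, h⟩ := exists_succ hAP hR s
      exact ⟨t, f, trivial, e, h⟩)
    (fun i hi G _ => by
      obtain ⟨k, hk⟩ := not_isMin_iff.1 hi.1
      have : Nonempty (Set.Iio i) := ⟨⟨k, hk⟩⟩
      obtain ⟨c, hc⟩ := exists_cocone hAP hR G
      exact ⟨c, trivial, hc⟩)
  exact ⟨F, hc, hs⟩

end IndepExt
/-- Existence of long independent isi-sequences. -/
theorem IsSimple.exists_indep_isi (hAP : 𝒦.AmalgamationProperty) {R : IndepRel 𝒦} (hR : R.IsSimple)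
    (b : Y ⟶ M.obj) (c : Z ⟶ M.obj) {θ : Cardinal.{v}} (hθ : θ.IsRegular) :
    ∃ (N : 𝒦.Model) (c' : Z ⟶ N.obj) (bs : θ.ord.ToType → (Y ⟶ N.obj)) (S : InitialSegments bs),
      S.IsIsi ∧ S.Embeds c' ∧ (∀ i, GtpEq₂ (bs i) c' b c) ∧
        ∀ i, R.Arr (bs i) (S.m i) c' := by
  have := Cardinal.noMaxOrder hθ.aleph0_le
  obtain ⟨F, hF, hs⟩ := IndepExt.exists_chain hAP hR b c θ.ord.ToType
  have hne : Nonempty θ.ord.ToType := by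
    rw [← Cardinal.mk_ne_zero_iff, Cardinal.mk_ord_toType]
    exact hθ.pos.ne'
  obtain ⟨N, ι, -⟩ := exists_model_colimit (F ⋙ IndepExt.baseFunctor)
    fun j => (F.obj j).base.property
  let ι' : ∀ j, (F.obj j).base.obj ⟶ N.obj := ι.app
  have hι : ∀ {i j} (h : i ≤ j), (F.map (homOfLE h)).base ≫ ι' j = ι' i :=
    fun h => (ι.naturality (homOfLE h)).trans (Category.comp_id _)
  choose e he using fun k => hs k (Order.succ k) (Order.covBy_succ k)
  have hm : ∀ k, (F.obj k).m ≫ e k ≫ ι' (Order.succ k) = ι' k := by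
    intro k
    rw [reassoc_of% he k, hι]
  obtain ⟨i₀, -, hi₀⟩ := WellFounded.has_min (wellFounded_lt (α := θ.ord.ToType)) Set.univ
    Set.univ_nonempty
  have hbot : IsBot i₀ := fun j => not_lt.1 (hi₀ j trivial)
  let c' : Z ⟶ N.obj := (F.obj i₀).c ≫ ι' i₀
  have hc : ∀ i, (F.obj i).c ≫ ι' i = c' := by
    intro i
    rw [← (F.map (homOfLE (hbot i))).c_base, Category.assoc, hι]
  -- The realization at stage `i` is placed in the next base via `e i`, not followed along the tops,
  -- where all realizations are identified.
  let bs : θ.ord.ToType → (Y ⟶ N.obj) := fun i => (F.obj i).b ≫ e i ≫ ι' (Order.succ i)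
  let S : InitialSegments bs :=
    { chain := F ⋙ IndepExt.baseFunctor
      isModel := fun i => (F.obj i).base.property
      continuous := hF
      toBound := ι
      factors := fun i => ⟨(F.obj i).b ≫ e i, Category.assoc _ _ _⟩ }
  have hgtp : ∀ i, GtpEq₂ (F.obj i).b (F.obj i).m (bs i) (ι' i) := by
    intro i
    have := GtpEq₂.of_hom (F.obj i).b (F.obj i).m (e i ≫ ι' (Order.succ i))
    rwa [hm] at this
  have hcm : ∀ i, (F.obj i).c ≫ (F.obj i).m ≫ e i ≫ ι' (Order.succ i) = c' := by
    intro i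
    rw [hm, hc]
  refine ⟨N, c', bs, S, fun i j hij => ?_, ⟨i₀, hbot, (F.obj i₀).c, rfl⟩, fun i => ?_, fun i => ?_⟩
  -- The map of tops sends the realization of stage `i` to that of stage `j`, so both have the same
  -- type over the base of stage `i`.
  · have h₁ := GtpEq₂.of_hom (F.obj i).b (F.obj i).m (F.map (homOfLE hij)).top
    rw [(F.map (homOfLE hij)).b_top, (F.map (homOfLE hij)).comm] at h₁
    have h₂ := (hgtp j).precomp (F.map (homOfLE hij)).base
    rw [hι] at h₂
    exact (hgtp i).symm.trans hAP (h₁.trans hAP h₂)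
  · have h₁ := (hgtp i).precomp (F.obj i).c
    rw [hc] at h₁
    exact h₁.symm.trans hAP (F.obj i).gtp
  · have h₁ := (hR.comp_iff _ _ _ (e i ≫ ι' (Order.succ i))).2 (F.obj i).indep
    rw [hm, Category.assoc, hcm] at h₁
    exact h₁

end IndepRel
end AECat

/-! ### Dependence implies isi-dividing. -/

namespace AECat

variable {𝒦 : AECat.{v, u}}

namespace InitialSegments

variable {κ : Cardinal.{v}} {Y Z : 𝒦.Obj} {N : 𝒦.Model} {b : κ.ord.ToType → (Y ⟶ N.obj)}

lemma map_m (S : InitialSegments b) {i j : κ.ord.ToType} (h : i ≤ j) :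
    S.chain.map (homOfLE h) ≫ S.m j = S.m i :=
  (S.toBound.naturality (homOfLE h)).trans (Category.comp_id _)

lemma exists_factor (S : InitialSegments b) {i j : κ.ord.ToType} (h : Order.succ i ≤ j) :
    ∃ g : Y ⟶ S.chain.obj j, g ≫ S.m j = b i := by
  obtain ⟨g, hg⟩ := S.factors i
  exact ⟨g ≫ S.chain.map (homOfLE h), by rw [Category.assoc, map_m]; exact hg⟩

lemma Embeds.exists_factor {S : InitialSegments b} {c : Z ⟶ N.obj} (h : S.Embeds c)
    (j : κ.ord.ToType) : ∃ g : Z ⟶ S.chain.obj j, g ≫ S.m j = c := by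
  obtain ⟨i, hi, g, hg⟩ := h
  exact ⟨g ≫ S.chain.map (homOfLE (hi j)), by rw [Category.assoc, map_m, hg]⟩

end InitialSegments

variable {X Y Z : 𝒦.Obj} {M : 𝒦.Model} {a : X ⟶ M.obj} {b : Y ⟶ M.obj} {c : Z ⟶ M.obj}

theorem IndepRel.IsSimple.isiDivides_of_not_indep (hAP : 𝒦.AmalgamationProperty)
    {R : IndepRel 𝒦} (hR : R.IsSimple) (h : ¬ R.Arr a b c) : IsiDivides a b c := by
  obtain ⟨Υ, hΥreg, hΥ⟩ := hR.exists_presentable_base X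
  -- With `μ` the successor of `Υ`, every `θ ≥ μ` exceeds `Υ`, so `Υ` itself can serve as the `κ` of
  -- isi-dividing.
  refine ⟨Order.succ Υ, Cardinal.isRegular_succ hΥreg.out.aleph0_le, fun θ hθ hle => ?_⟩
  have hlt : Υ < θ := (Order.lt_succ Υ).trans_le hle
  have := Cardinal.noMaxOrder hθ.aleph0_le
  obtain ⟨N, c', bs, S, hS, hc, hg, hind⟩ := hR.exists_indep_isi hAP b c hθ
  refine ⟨N, c', bs, S, hS, hc, hg, Υ, hΥreg.out, hlt, fun I hI => ?_⟩
  rintro ⟨N', f, a', ha'⟩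
  refine h ?_
  obtain ⟨l, hl⟩ := hθ.exists_forall_bounded_below hΥreg.out hlt I hI
  have hl' : ∀ s : Set θ.ord.ToType, s ⊆ Set.Iio l → Cardinal.mk s < Υ →
      ∃ x < l, ∀ y ∈ s, y < x := fun s hs hs' => by
    obtain ⟨x, -, hx⟩ := hl s hs hs'
    exact ⟨x, hx⟩
  have hlim := Order.isSuccLimit_of_forall_bounded hΥreg.out.aleph0_le hl'
  have := S.continuous
  obtain ⟨k, hk, hkind⟩ := hR.exists_indep_of_chain le_rfl hΥ S.chain
    (S.toBound ≫ (Functor.const _).map f) hl' a'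
  -- `x` must lie in `I`, where `a'` realizes the type, and past `k`, where local character holds.
  obtain ⟨x, hxI, hxl, hkx⟩ := hl {k} (by simpa using hk)
    (by simpa using Cardinal.one_lt_aleph0.trans_le hΥreg.out.aleph0_le)
  have hax : R.Arr a' (S.m l ≫ f) (S.m x ≫ f) := hkind x (hkx k rfl).le hxl
  obtain ⟨g, hg'⟩ := S.exists_factor (hlim.succ_lt hxl).le
  have hax' := hR.mono_right hax g
  rw [reassoc_of% hg'] at hax'
  obtain ⟨s, hs⟩ := hc.exists_factor x
  have hbx := (hR.comp_iff _ _ _ f).2 (hind x)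
  -- From `b_x ⊥_c M_x` and `b_x ⊥_{M_x} a'` follows `b_x ⊥_c a'`.
  have := hR.trans_right hbx (hR.symmetry _ _ _ hax') s (by rw [reassoc_of% hs])
  exact hR.of_gtpEq (hR.symmetry _ _ _ this) (ha' ⟨x, hxI⟩).symm

end AECat

/-! ### Realizing a type along a chain by 3-amalgamation. -/

lemma CategoryTheory.Functor.map_homOfLE_comp {K C : Type*} [Preorder K] [Category* C] (F : K ⥤ C)
    {i j k : K} (h : i ≤ j) (h' : j ≤ k) :
    F.map (homOfLE h) ≫ F.map (homOfLE h') = F.map (homOfLE (h.trans h')) := by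
  rw [← F.map_comp]
  rfl

lemma CategoryTheory.Functor.map_homOfLE_comp_assoc {K C : Type*} [Preorder K] [Category* C]
    (F : K ⥤ C) {i j k : K} (h : i ≤ j) (h' : j ≤ k) {X : C} (f : F.obj k ⟶ X) :
    F.map (homOfLE h) ≫ F.map (homOfLE h') ≫ f = F.map (homOfLE (h.trans h')) ≫ f := by
  rw [← F.map_homOfLE_comp h h', Category.assoc]

lemma CategoryTheory.Functor.map_homOfLE_self {K C : Type*} [Preorder K] [Category* C] (F : K ⥤ C)
    {i : K} (h : i ≤ i) : F.map (homOfLE h) = 𝟙 _ :=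
  F.map_id i

namespace AECat

variable {𝒦 : AECat.{v, u}} {X Y : 𝒦.Obj}

namespace IndepRel

variable (R : IndepRel 𝒦) {K : Type v} [LinearOrder K] (F : K ⥤ 𝒦.Obj) {N N₁ : 𝒦.Model}
  (mN : F ⟶ (Functor.const K).obj N.obj) (b : K → (Y ⟶ N.obj)) {j : K} (hj : IsBot j)
  (a₁ : X ⟶ N₁.obj) (b₁ : Y ⟶ N₁.obj) (m₁ : F.obj j ⟶ N₁.obj)

/-- An extension of a member `F.obj idx` of a chain of models together with a realization `a` of
the Galois type of `a₁` over the first member of the chain, which is independent from `F.obj idx`,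
and satisfies `gtp(a, b i, F.obj j) = gtp(a₁, b₁, m₁)` for all `i < idx`. -/
structure IndepRealization where
  idx : K
  top : 𝒦.Model
  m : F.obj idx ⟶ top.obj
  a : X ⟶ top.obj
  indep : R.Arr a m (F.map (homOfLE (hj idx)) ≫ m)
  gtp : GtpEq₂ a (F.map (homOfLE (hj idx)) ≫ m) a₁ m₁
  gtp_seq : ∀ i < idx, ∀ g : Y ⟶ F.obj idx, g ≫ mN.app idx = b i →
    GtpEq₃ a (g ≫ m) (F.map (homOfLE (hj idx)) ≫ m) a₁ b₁ m₁

namespace IndepRealization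

variable {R F mN b hj a₁ b₁ m₁}

/-- Morphisms of independent realizations. -/
@[ext]
structure Hom (s t : IndepRealization R F mN b hj a₁ b₁ m₁) where
  le : s.idx ≤ t.idx
  top : s.top.obj ⟶ t.top.obj
  comm : s.m ≫ top = F.map (homOfLE le) ≫ t.m
  a_top : s.a ≫ top = t.a

instance : Category (IndepRealization R F mN b hj a₁ b₁ m₁) where
  Hom := Hom
  id s := ⟨le_rfl, 𝟙 _, by
    rw [F.map_homOfLE_self, Category.comp_id, Category.id_comp], Category.comp_id _⟩
  comp f g := ⟨f.le.trans g.le, f.top ≫ g.top, by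
    rw [reassoc_of% f.comm, g.comm, ← Category.assoc, F.map_homOfLE_comp], by
    rw [reassoc_of% f.a_top, g.a_top]⟩
  id_comp f := Hom.ext (Category.id_comp _)
  comp_id f := Hom.ext (Category.comp_id _)
  assoc f g h := Hom.ext (Category.assoc _ _ _)

/-- The functor sending an independent realization to the model where it lives. -/
def topFunctor : IndepRealization R F mN b hj a₁ b₁ m₁ ⥤ 𝒦.Obj where
  obj s := s.top.obj
  map f := f.top

lemma exists_initial (hR : R.IsSimple) {i : K} (hi : IsMin i) :
    ∃ s : IndepRealization R F mN b hj a₁ b₁ m₁, s.idx = i := by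
  obtain rfl : i = j := le_antisymm (hi.isBot j) (hj i)
  refine ⟨⟨i, N₁, m₁, a₁, ?_, ?_, fun k hk => (hi.not_lt hk).elim⟩, rfl⟩
  · rw [F.map_homOfLE_self, Category.id_comp]
    exact hR.indep_base a₁ m₁
  · rw [F.map_homOfLE_self, Category.id_comp]
    exact ⟨N₁, 𝟙 _, 𝟙 _, rfl, rfl⟩

lemma mN_map {i k : K} (h : i ≤ k) : F.map (homOfLE h) ≫ mN.app k = mN.app i :=
  (mN.naturality (homOfLE h)).trans (Category.comp_id _)

/-- 3-amalgamation over the bottom model `F.obj j`, with sides `a₁, b₁` in `N₁`, `b s.idx, F.obj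
s.idx` in `N`, and `F.obj s.idx, s.a` in `s.top`. Its conclusion gives independence from all of `N`,
hence from the next model of the chain. -/
lemma exists_succ (hAP : 𝒦.AmalgamationProperty) (hR : R.IsSimple)
    (hmodel : ∀ i, 𝒦.IsModel (F.obj i)) (h₁ : R.Arr a₁ b₁ m₁)
    (hindep : ∀ i, R.Arr (b i) (mN.app i) (mN.app j))
    (hgtp : ∀ i, GtpEq₂ b₁ m₁ (b i) (mN.app j))
    (hfac : ∀ i k, i < k → ∃ g : Y ⟶ F.obj k, g ≫ mN.app k = b i)
    (s : IndepRealization R F mN b hj a₁ b₁ m₁) {k : K} (hk : s.idx ⋖ k) :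
    ∃ (t : IndepRealization R F mN b hj a₁ b₁ m₁) (_ : s ⟶ t), t.idx = k := by
  obtain ⟨U, p, q, e⟩ := hAP ⟨F.obj s.idx, hmodel _⟩ N s.top (mN.app s.idx) s.m
  obtain ⟨P, f₁, f₂, f₃, ha, hb, hc, hm₂, hm₃, hind⟩ := hR.threeAmalgamation
    (M := ⟨F.obj j, hmodel _⟩) a₁ s.a b₁ (b s.idx) (mN.app s.idx) s.m m₁ (mN.app j)
    (F.map (homOfLE (hj s.idx)) ≫ s.m) h₁ (hindep s.idx) (hR.symmetry _ _ _ s.indep) s.gtp.symm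
    (hgtp s.idx) ⟨U, p, q, e, by rw [← mN_map (hj s.idx), Category.assoc, e, Category.assoc]⟩
  have hbase : F.map (homOfLE (hj k)) ≫ mN.app k ≫ f₂ = m₁ ≫ f₁ := by
    rw [← Category.assoc, mN_map, hm₂]
  refine ⟨⟨k, P, mN.app k ≫ f₂, s.a ≫ f₃, ?_, ?_, fun i hi g hg => ?_⟩,
    ⟨hk.le, f₃, ?_, rfl⟩, rfl⟩
  · rw [hbase, ← ha]
    exact hR.mono_right hind (mN.app k)
  · rw [hbase, ← ha]
    exact (GtpEq₂.of_hom _ _ _).symm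
  · rw [hbase, ← Category.assoc, hg]
    -- Earlier members lie in `F.obj s.idx` and keep their type with `s.a`; the member at `s.idx` is
    -- identified with `b₁` by the amalgam.
    rcases (hk.le_of_lt hi).lt_or_eq with h | h
    · obtain ⟨g', hg'⟩ := hfac i s.idx h
      have := (GtpEq₃.of_hom _ _ _ f₃).symm.trans hAP (s.gtp_seq i h g' hg')
      rwa [← hm₃, Category.assoc, ← hc, ← Category.assoc, hg'] at this
    · subst h
      rw [← ha, ← hb]
      exact (GtpEq₃.of_hom _ _ _ _).symm
  · exact (by rw [← hc, ← Category.assoc, mN_map] :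
      s.m ≫ f₃ = F.map (homOfLE hk.le) ≫ mN.app k ≫ f₂)

lemma exists_cocone (hAP : 𝒦.AmalgamationProperty) (hR : R.IsSimple) [F.IsWellOrderContinuous]
    (hfac : ∀ i k, i < k → ∃ g : Y ⟶ F.obj k, g ≫ mN.app k = b i) {l : K}
    (hl : Order.IsSuccLimit l) (G : Set.Iio l ⥤ IndepRealization R F mN b hj a₁ b₁ m₁)
    (hG : ∀ k, (G.obj k).idx = k.1) :
    ∃ c : Cocone G, c.pt.idx = l ∧ Nonempty (IsColimit (topFunctor.mapCocone c)) := by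
  obtain ⟨k₀, hk₀⟩ := not_isMin_iff.1 hl.1
  have : Nonempty (Set.Iio l) := ⟨⟨k₀, hk₀⟩⟩
  obtain ⟨U, κ, ⟨hκ⟩⟩ := exists_model_colimit (G ⋙ topFunctor) fun k => (G.obj k).top.property
  let κ' : ∀ k, (G.obj k).top.obj ⟶ U.obj := κ.app
  have hκ' : ∀ {k k' : Set.Iio l} (f : k ⟶ k'), (G.map f).top ≫ κ' k' = κ' k :=
    fun f => (κ.naturality f).trans (Category.comp_id _)
  have hF := F.isColimitOfIsWellOrderContinuous l hl
  -- The index of `G.obj k` equals `k` only propositionally; `F.map` of the inequality replaces a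
  -- cast.
  let leg : ∀ k : Set.Iio l, F.obj k.1 ⟶ U.obj :=
    fun k => F.map (homOfLE (hG k).ge) ≫ (G.obj k).m ≫ κ' k
  have hleg : ∀ {k k' : Set.Iio l} (h : k.1 ≤ k'.1), F.map (homOfLE h) ≫ leg k' = leg k := by
    intro k k' h
    have e := (G.map (homOfLE (show k ≤ k' from h))).comm
    change _ ≫ F.map _ ≫ _ ≫ _ = F.map _ ≫ _ ≫ _
    rw [← hκ' (homOfLE (show k ≤ k' from h)), reassoc_of% e,
      F.map_homOfLE_comp_assoc, F.map_homOfLE_comp_assoc]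
  let m : F.obj l ⟶ U.obj := hF.desc ⟨U.obj, {
    app := leg
    naturality := fun k k' f => (hleg (leOfHom f)).trans (Category.comp_id _).symm }⟩
  have hm : ∀ k : Set.Iio l, F.map (homOfLE (le_of_lt k.2)) ≫ m = leg k := hF.fac _
  have hmc : ∀ k : Set.Iio l, (G.obj k).m ≫ κ' k =
      F.map (homOfLE ((hG k).trans_le (le_of_lt k.2))) ≫ m := by
    intro k
    rw [← F.map_homOfLE_comp (hG k).le (le_of_lt k.2), Category.assoc, hm]
    change _ = F.map _ ≫ F.map _ ≫ _
    rw [F.map_homOfLE_comp_assoc, F.map_homOfLE_self, Category.id_comp]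
  have hbase : ∀ k : Set.Iio l, (F.map (homOfLE (hj (G.obj k).idx)) ≫ (G.obj k).m) ≫ κ' k =
      F.map (homOfLE (hj l)) ≫ m := by
    intro k
    rw [Category.assoc, hmc, ← Category.assoc, F.map_homOfLE_comp]
  let k₀ : Set.Iio l := ⟨k₀, hk₀⟩
  have ha : ∀ k, (G.obj k).a ≫ κ' k = (G.obj k₀).a ≫ κ' k₀ := by
    intro k
    obtain ⟨k', h, h₀⟩ := exists_ge_ge k k₀
    rw [← hκ' (homOfLE h), ← hκ' (homOfLE h₀), reassoc_of% (G.map (homOfLE h)).a_top,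
      reassoc_of% (G.map (homOfLE h₀)).a_top]
  let t : IndepRealization R F mN b hj a₁ b₁ m₁ :=
    { idx := l
      top := U
      m := m
      a := (G.obj k₀).a ≫ κ' k₀
      indep := by
        refine hR.union (Set.Iio l) _ _ hF m _ _ fun k => ?_
        have h := hR.mono_right ((hR.comp_iff _ _ _ (κ' k)).2 (G.obj k).indep)
          (F.map (homOfLE (hG k).ge))
        rw [hbase, ha] at h
        change R.Arr _ (F.map (homOfLE (le_of_lt k.2)) ≫ m) _
        rw [hm]
        exact h
      gtp := by
        rw [← hbase k₀]
        exact (GtpEq₂.of_hom _ _ _).symm.trans hAP (G.obj k₀).gtp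
      gtp_seq := fun i hi g hg => by
        obtain ⟨k, hik, hkl⟩ : ∃ k, i < k ∧ k < l := by
          by_contra! h
          exact hl.2 i ⟨hi, fun k hik => (h k hik).not_gt⟩
        let k' : Set.Iio l := ⟨k, hkl⟩
        have hik' : i < (G.obj k').idx := hik.trans_eq (hG k').symm
        obtain ⟨g', hg'⟩ := hfac i _ hik'
        -- Arrows are monomorphisms, so `b i` factors through `F.obj l` in only one way.
        have hgg : g' ≫ F.map (homOfLE ((hG k').trans_le (le_of_lt k'.2))) = g := by
          have hmono : Mono (mN.app l : F.obj l ⟶ N.obj) := 𝒦.mono _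
          rw [← cancel_mono (mN.app l : F.obj l ⟶ N.obj), hg, Category.assoc, mN_map, hg']
        have h := (GtpEq₃.of_hom _ _ _ (κ' k')).symm.trans hAP ((G.obj k').gtp_seq i hik' g' hg')
        rw [hbase, ha, Category.assoc, hmc, ← Category.assoc, hgg] at h
        exact h }
  refine ⟨⟨t, {
    app := fun k => ⟨(hG k).trans_le (le_of_lt k.2), κ' k, hmc k, ha k⟩
    naturality := fun k k' f => Hom.ext ((hκ' f).trans (Category.comp_id _).symm) }⟩, rfl, ⟨hκ⟩⟩

end IndepRealization

/-- The independence theorem for chains: an independent realization over a large index. -/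
theorem IsSimple.exists_realization (hAP : 𝒦.AmalgamationProperty) {R : IndepRel 𝒦}
    (hR : R.IsSimple) {K : Type v} [LinearOrder K] [WellFoundedLT K] (F : K ⥤ 𝒦.Obj)
    [F.IsWellOrderContinuous] (hmodel : ∀ i, 𝒦.IsModel (F.obj i)) {N N₁ : 𝒦.Model}
    (mN : F ⟶ (Functor.const K).obj N.obj) (b : K → (Y ⟶ N.obj))
    (hfac : ∀ i k, i < k → ∃ g : Y ⟶ F.obj k, g ≫ mN.app k = b i) {j : K} (hj : IsBot j)
    (hindep : ∀ i, R.Arr (b i) (mN.app i) (mN.app j))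
    (a₁ : X ⟶ N₁.obj) (b₁ : Y ⟶ N₁.obj) (m₁ : F.obj j ⟶ N₁.obj) (h₁ : R.Arr a₁ b₁ m₁)
    (hgtp : ∀ i, GtpEq₂ b₁ m₁ (b i) (mN.app j)) (l : K) :
    ∃ (U : 𝒦.Model) (f : N.obj ⟶ U.obj) (a : X ⟶ U.obj), ∀ i < l,
      GtpEq₃ a₁ b₁ m₁ a (b i ≫ f) (mN.app j ≫ f) := by
  obtain ⟨G, hG, -, -⟩ := exists_functor_of_transfinite_extension (K := K)
    (IndepRealization.topFunctor : IndepRealization R F mN b hj a₁ b₁ m₁ ⥤ 𝒦.Obj)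
    (fun i s => s.idx = i) ⊤ (fun i hi => IndepRealization.exists_initial hR hi)
    (fun k i h s hs => by
      subst hs
      obtain ⟨t, f, ht⟩ := s.exists_succ hAP hR hmodel h₁ hindep hgtp hfac h
      exact ⟨t, f, ht, trivial⟩)
    (fun i hi G hG => IndepRealization.exists_cocone hAP hR hfac hi G hG)
  obtain ⟨s, hs⟩ : ∃ s : IndepRealization R F mN b hj a₁ b₁ m₁, s.idx = l := ⟨_, hG l⟩
  subst hs
  -- Amalgamating over `F.obj s.idx` brings the realization and the whole sequence into one model.
  obtain ⟨U, f, f', e⟩ := hAP ⟨F.obj s.idx, hmodel _⟩ N s.top (mN.app s.idx) s.m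
  refine ⟨U, f, s.a ≫ f', fun i hi => ?_⟩
  obtain ⟨g, hg⟩ := hfac i _ hi
  have h := (s.gtp_seq i hi g hg).symm.trans hAP (GtpEq₃.of_hom _ _ _ f')
  rw [Category.assoc, Category.assoc, ← e, ← Category.assoc, hg, ← Category.assoc,
    IndepRealization.mN_map] at h
  exact h

end IndepRel
end AECat

/-! ### Independence implies that there is no isi-dividing. -/

namespace AECat

variable {𝒦 : AECat.{v, u}} {X Y Z : 𝒦.Obj} {M : 𝒦.Model}

lemma GtpEq₂.gtpEq₃ {M' : 𝒦.Model} {x : X ⟶ M.obj} {y : Y ⟶ M.obj} {x' : X ⟶ M'.obj}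
    {y' : Y ⟶ M'.obj} (h : GtpEq₂ x y x' y') (t : Z ⟶ Y) :
    GtpEq₃ x y (t ≫ y) x' y' (t ≫ y') := by
  obtain ⟨N, f, g, h₁, h₂⟩ := h
  exact ⟨N, f, g, h₁, h₂, by rw [Category.assoc, h₂, Category.assoc]⟩

/-- Along an isi-sequence, independence of a late member from the chain passes to earlier ones. -/
lemma InitialSegments.IsIsi.indep_of_le {R : IndepRel 𝒦} (hR : R.IsSimple) {κ : Cardinal.{v}}
    {N : 𝒦.Model} {b : κ.ord.ToType → (Y ⟶ N.obj)} {S : InitialSegments b} (hS : S.IsIsi)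
    {i j l : κ.ord.ToType} (h : R.Arr (b l) (S.m l) (S.m j)) (hji : j ≤ i) (hil : i ≤ l) :
    R.Arr (b i) (S.m i) (S.m j) := by
  have h' := hR.mono_right h (S.chain.map (homOfLE hil))
  rw [S.map_m] at h'
  refine hR.of_gtpEq h' ?_
  have e := (hS i l hil).symm.gtpEq₃ (S.chain.map (homOfLE hji))
  rwa [S.map_m] at e

variable {a : X ⟶ M.obj} {b : Y ⟶ M.obj} {c : Z ⟶ M.obj}

/-- The base is changed from `c` to the model `M_j`, as 3-amalgamation requires. A copy of `a` is
made independent over `c` from `M_{j+1}`, which contains both `M_j` and `b_j`; base monotonicity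
then gives independence from `b_j` over `M_j`. -/
lemma IndepRel.IsSimple.exists_realization_isi (hAP : 𝒦.AmalgamationProperty) {R : IndepRel 𝒦}
    (hR : R.IsSimple) (h : R.Arr a b c) {θ : Cardinal.{v}} (hθ : θ.IsRegular) {N : 𝒦.Model}
    {c' : Z ⟶ N.obj} {bs : θ.ord.ToType → (Y ⟶ N.obj)} {S : InitialSegments bs} (hS : S.IsIsi)
    (hc : S.Embeds c') (hg : ∀ i, GtpEq₂ (bs i) c' b c) {j l : θ.ord.ToType} (hjl : j ≤ l)
    (hind : R.Arr (bs l) (S.m l) (S.m j)) :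
    ∃ (U : 𝒦.Model) (f : N.obj ⟶ U.obj) (a' : X ⟶ U.obj), ∀ i, j ≤ i → i < l →
      GtpEq₃ a b c a' (bs i ≫ f) (c' ≫ f) := by
  have := Cardinal.noMaxOrder hθ.aleph0_le
  have := S.continuous
  obtain ⟨Q, p, q, hb, hcc⟩ := hg j
  have h' := (hR.comp_iff _ _ _ q).2 h
  rw [← hb, ← hcc] at h'
  obtain ⟨N₁, f₁, a₁, g₁, hind₁⟩ := hR.exists_extension h' (S.m (Order.succ j) ≫ p)
  rw [Category.assoc, Category.assoc] at hind₁
  obtain ⟨s, hs⟩ := hc.exists_factor j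
  have hbase := hR.base_mono hind₁ (d := S.m j ≫ p ≫ f₁) s (by rw [reassoc_of% hs])
    (S.chain.map (homOfLE (Order.le_succ j))) (by rw [← Category.assoc, S.map_m])
  obtain ⟨g, hg'⟩ := S.exists_factor (le_refl (Order.succ j))
  have h₁ := hR.mono_right hbase g
  rw [reassoc_of% hg'] at h₁
  -- The chain is cut down to the interval from `j` to `l`, so that `M_j` becomes its bottom.
  let F : Set.Iic (⟨l, hjl⟩ : Set.Ici j) ⥤ 𝒦.Obj :=
    (Set.initialSegIic (⟨l, hjl⟩ : Set.Ici j)).monotone.functor ⋙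
      (Subtype.mono_coe (· ∈ Set.Ici j)).functor ⋙ S.chain
  have hF : F.IsWellOrderContinuous := inferInstance
  let mN : F ⟶ (Functor.const _).obj N.obj :=
    { app := fun i => S.m i.1.1
      naturality := fun i k f => S.toBound.naturality (homOfLE (leOfHom f)) }
  obtain ⟨U, f, a', ha'⟩ := hR.exists_realization hAP F (fun i => S.isModel i.1.1) mN
    (fun i => bs i.1.1) (fun i k hik => S.exists_factor (Order.succ_le_of_lt hik))
    (j := ⟨⟨j, Set.mem_Ici.2 le_rfl⟩, hjl⟩) (fun i => i.1.2)
    (fun i => hS.indep_of_le hR hind i.1.2 i.2) a₁ (bs j ≫ p ≫ f₁) (S.m j ≫ p ≫ f₁) h₁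
    (fun i => (GtpEq₂.of_hom _ _ _).symm.trans hAP (hS j i.1.1 i.1.2)) ⟨⟨l, hjl⟩, Set.mem_Iic.2 le_rfl⟩
  refine ⟨U, f, a', fun i hji hil => ?_⟩
  have e : GtpEq₃ a₁ (bs j ≫ p ≫ f₁) (S.m j ≫ p ≫ f₁) a' (bs i ≫ f) (S.m j ≫ f) :=
    ha' ⟨⟨i, hji⟩, hil.le⟩ hil
  have e' := e.precomp s
  rw [reassoc_of% hs, reassoc_of% hs] at e'
  have e₁ := GtpEq₃.of_hom a b c q
  rw [← hb, ← hcc] at e₁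
  rw [Category.assoc, Category.assoc] at g₁
  exact e₁.trans hAP (g₁.symm.trans hAP e')

theorem IndepRel.IsSimple.not_isiDivides_of_indep (hAP : 𝒦.AmalgamationProperty)
    {R : IndepRel 𝒦} (hR : R.IsSimple) (h : R.Arr a b c) : ¬ IsiDivides a b c := by
  rintro ⟨μ, hμ, hdiv⟩
  obtain ⟨Υ, hΥreg, hΥ⟩ := hR.exists_presentable_base Y
  -- Taking `θ` to be the successor of a regular `ν` above `μ` and `Υ` forces every `κ < θ` to
  -- satisfy `κ ≤ ν`, so `ν` many consistent members suffice.
  have hν : (Order.succ (max μ Υ)).IsRegular :=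
    Cardinal.isRegular_succ (hμ.aleph0_le.trans (le_max_left _ _))
  set ν := Order.succ (max μ Υ) with hνdef
  have hμν : μ ≤ ν := (le_max_left _ _).trans (Order.le_succ _)
  have hΥν : Υ ≤ ν := (le_max_right _ _).trans (Order.le_succ _)
  have : Fact ν.IsRegular := ⟨hν⟩
  have hθ : (Order.succ ν).IsRegular := Cardinal.isRegular_succ hν.aleph0_le
  obtain ⟨N, c', bs, S, hS, hc, hg, κ, -, hκν, hno⟩ :=
    hdiv (Order.succ ν) hθ (hμν.trans (Order.le_succ _))
  obtain ⟨l, hl⟩ := hθ.exists_forall_bounded_below hν (Order.lt_succ ν) Set.univ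
    (by rw [Cardinal.mk_univ, Cardinal.mk_ord_toType]; exact Order.le_succ ν)
  have hl' : ∀ s : Set (Order.succ ν).ord.ToType, s ⊆ Set.Iio l → Cardinal.mk s < ν →
      ∃ x < l, ∀ y ∈ s, y < x := fun s hs hs' => by
    obtain ⟨x, -, hx⟩ := hl s hs hs'
    exact ⟨x, hx⟩
  have := S.continuous
  obtain ⟨j, hjl, hj⟩ := hR.exists_indep_of_chain hΥν hΥ S.chain S.toBound hl' (bs l)
  obtain ⟨U, f, a', ha'⟩ := hR.exists_realization_isi hAP h hθ hS hc hg hjl.le (hj j le_rfl hjl)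
  refine hno (Set.Ico j l) ((Order.lt_succ_iff.1 hκν).trans ?_)
    ⟨U, f, a', fun i => ha' i.1 i.2.1 i.2.2⟩
  -- The interval `[j, l)` is cofinal below `l`, so with fewer than `ν` elements it would have a
  -- strict upper bound `x < l`, itself in the interval.
  by_contra! hcard
  obtain ⟨x, hxl, hx⟩ := hl' (Set.Ico j l) (fun i hi => hi.2) hcard
  exact lt_irrefl x (hx x ⟨(hx j ⟨le_rfl, hjl⟩).le, hxl⟩)

end AECat

theorem mainTheorem1 (𝒦 : AECat.{v, u}) (hAP : 𝒦.AmalgamationProperty)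
    (R : AECat.IndepRel 𝒦) (hR : R.IsSimple)
    (M : 𝒦.Model) (A B C : Subobject M.obj)
    -- arbitrary representatives of the three subobjects
    {X Y Z : 𝒦.Obj} (a : X ⟶ M.obj) (b : Y ⟶ M.obj) (c : Z ⟶ M.obj)
    (ha : Subobject.mk a = A) (hb : Subobject.mk b = B) (hc : Subobject.mk c = C) :
    R A B C ↔ ¬ AECat.IsiDivides a b c := by
  subst ha hb hc
  exact ⟨hR.not_isiDivides_of_indep hAP, fun h => by
    by_contra h'
    exact h (hR.isiDivides_of_not_indep hAP h')⟩
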